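/- Let $0\le\nu<m$, let $M\in\mathbb{R}^{m\times m}$ be symmetric positive definite, and let $U:\mathbb{R}^m\to\mathbb{R}$, $g:\mathbb{R}^m\to\mathbb{R}^\nu$ be analytic. Let $\nabla g(q)\in\mathbb{R}^{m\times\nu}$ denote the transposed Jacobian of $g$, and assume that $\nabla g(q)^\top M^{-1}\nabla g(q)$ is nonsingular whenever $g(q)=0$. Put $H(q,p)=\frac12p^\top M^{-1}p+U(q)$ and $$\lambda(q,p)=\left[\nabla g(q)^\top M^{-1}\nabla g(q)\right]^{-1}\left[\nabla^2g(q)(M^{-1}p,M^{-1}p)-\nabla g(q)^\top M^{-1}\nabla U(q)\right].$$ Let $T>0$, let $q_0,p_0\in\mathbb{R}^m$ satisfy $g(q_0)=0$ and $\nabla g(q_0)^\top M^{-1}p_0=0$, and let $(q(t),p(t))$, with some multiplier $\lambda(t)\in\mathbb{R}^\nu$, solve $$\dot q=M^{-1}p,\qquad \dot p=-\nabla U(q)-\nabla g(q)\lambda(t),\qquad g(q)=0,\qquad q(0)=q_0,\ p(0)=p_0,\qquad t\in[0,T].$$ For a stepsize $h>0$, a step of the procedure from $(q_n,p_n)$ at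 $t_n=nh$ chooses a constant vector $\lambda_n\in\mathbb{R}^\nu$ such that the solution $(u,v)$ of $\dot u=M^{-1}v$, $\dot v=-\nabla U(u)-\nabla g(u)\lambda_n$ on $[t_n,t_{n+1}]$, with $u(t_n)=q_n$, $v(t_n)=p_n$, exists and satisfies $g(u(t_{n+1}))=0$, and sets $q_{n+1}=u(t_{n+1})$, $p_{n+1}=v(t_{n+1})$. Then there is a constant $C$, depending neither on $h$ nor on $n$, such that for every $\rho>0$ there is $h_0>0$ such that for all $0<h\le h_0$ the procedure defines a sequence $(q_n,p_n,\lambda_n)$ starting from $(q_0,p_0)$ with the following properties. For all $n\ge0$ with $nh\le T$, $$\|q_n-q(nh)\|\le Ch,\qquad \|p_n-p(nh)\|\le Ch,\qquad g(q_n)=0,\qquad \|\nabla g(q_n)^\top M^{-1}p_n\|\le Ch^2.$$ For all $n\ge0$ with $(n+1)h\le T$, $(q_{n+1},p_{n+1})$ is obtained from $(q_n,p_n)$ by a step of the procedure with the constant vector $\lambda_n$; no other vector within distance $\rho$ of $\lambda(q(nh),p(nh))$ is admissible in this step; and $$\|\lambda_n-\lambda(q(nh),p(nh))\|\le Ch,\qquad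 H(q_{n+1},p_{n+1})=H(q_n,p_n).$$ -/

import Mathlib

open Set

noncomputable section

namespace ConstrainedHam

/-- The space `ℝⁿ` with its Euclidean norm. -/
abbrev Vec (n : ℕ) : Type := EuclideanSpace ℝ (Fin n)

/-- The product `A x` of a matrix with a column vector. -/
def mulV {a b : ℕ} (A : Matrix (Fin a) (Fin b) ℝ) (x : Vec b) : Vec a :=
  WithLp.toLp 2 (A.mulVec x.ofLp)

/-- The Hamiltonian `H(q,p) = ½ pᵀ M⁻¹ p + U(q)`. -/
def energy {m : ℕ} (M : Matrix (Fin m) (Fin m) ℝ) (U : Vec m → ℝ) (q p : Vec m) : ℝ :=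
  1 / 2 * inner ℝ p (mulV M⁻¹ p) + U q

/-- `∇g(q) ∈ ℝ^{m × ν}`: the `j`-th column is the gradient of the `j`-th component of `g`. -/
def gradC {m ν : ℕ} (g : Vec m → Vec ν) (q : Vec m) : Matrix (Fin m) (Fin ν) ℝ :=
  Matrix.of fun i j => (fderiv ℝ g q (EuclideanSpace.single i (1 : ℝ))) j

/-- The `ν × ν` matrix `∇g(q)ᵀ M⁻¹ ∇g(q)`. -/
def gramC {m ν : ℕ} (M : Matrix (Fin m) (Fin m) ℝ) (g : Vec m → Vec ν) (q : Vec m) :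
    Matrix (Fin ν) (Fin ν) ℝ :=
  (gradC g q).transpose * M⁻¹ * gradC g q

/-- The residual `∇g(q)ᵀ M⁻¹ p` of the hidden constraints. -/
def hidden {m ν : ℕ} (M : Matrix (Fin m) (Fin m) ℝ) (g : Vec m → Vec ν) (q p : Vec m) : Vec ν :=
  mulV (gradC g q).transpose (mulV M⁻¹ p)

/-- The multiplier as a function of the state,
`λ(q,p) = [∇gᵀ M⁻¹ ∇g]⁻¹ [∇²g(q)(M⁻¹p, M⁻¹p) - ∇gᵀ M⁻¹ ∇U(q)]`. -/
def multiplier {m ν : ℕ} (M : Matrix (Fin m) (Fin m) ℝ) (U : Vec m → ℝ) (g : Vec m → Vec ν)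
    (q p : Vec m) : Vec ν :=
  mulV (gramC M g q)⁻¹
    (fderiv ℝ (fun x => fderiv ℝ g x) q (mulV M⁻¹ p) (mulV M⁻¹ p)
      - mulV (gradC g q).transpose (mulV M⁻¹ (gradient U q)))

/-- `(q,p)` solves `q' = M⁻¹ p`, `p' = -∇U(q) - ∇g(q) λ(t)` on `[a,b]` (one-sided derivatives at
the end points). -/
structure IsMotion {m ν : ℕ} (M : Matrix (Fin m) (Fin m) ℝ) (U : Vec m → ℝ) (g : Vec m → Vec ν)
    (a b : ℝ) (lam : ℝ → Vec ν) (q p : ℝ → Vec m) : Prop where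
  deriv_q : ∀ t ∈ Icc a b, HasDerivWithinAt q (mulV M⁻¹ (p t)) (Icc a b) t
  deriv_p : ∀ t ∈ Icc a b,
    HasDerivWithinAt p (-gradient U (q t) - mulV (gradC g (q t)) (lam t)) (Icc a b) t

/-- `(q,p)`, with Lagrange multiplier `lam`, solves the constrained Hamiltonian problem on `[0,T]`
with initial values `q₀, p₀`. -/
structure IsConstrainedSolution {m ν : ℕ} (M : Matrix (Fin m) (Fin m) ℝ) (U : Vec m → ℝ)
    (g : Vec m → Vec ν) (q₀ p₀ : Vec m) (T : ℝ) (q p : ℝ → Vec m) (lam : ℝ → Vec ν) : Prop where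
  motion : IsMotion M U g 0 T lam q p
  constr : ∀ t ∈ Icc 0 T, g (q t) = 0
  init_q : q 0 = q₀
  init_p : p 0 = p₀

/-- One step of the procedure from time `a` to time `b`: with the constant multiplier `mu`, the
local problem on `[a,b]` started at `(q,p)` ends at `(q',p')`, and `g(q') = 0`. -/
def IsStep {m ν : ℕ} (M : Matrix (Fin m) (Fin m) ℝ) (U : Vec m → ℝ) (g : Vec m → Vec ν)
    (a b : ℝ) (q p : Vec m) (mu : Vec ν) (q' p' : Vec m) : Prop :=
  ∃ u v : ℝ → Vec m, IsMotion M U g a b (fun _ => mu) u v ∧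
    u a = q ∧ v a = p ∧ u b = q' ∧ v b = p' ∧ g q' = 0

end ConstrainedHam

end

noncomputable section

namespace ConstrainedHam

/-! Read the multiplier as a control and `g(q)` as an output whose second derivative along motions
is the first one containing the control, in the affine form `acc(y, μ) = acc(y, 0) - G(y) μ` with
`G` invertible on the constraint set. Over a step of length `h`, the final output depends on `μ`
through `-(h²/2) G μ` up to a relative error `O(h)`. A frozen Newton map is then a contraction,
which gives existence (`Bounds.exists_control`); the same estimate gives uniqueness
(`Bounds.control_unique`).

The danger is the hidden constraint: the control error contains `(2/h) ‖w1‖`, so `w1`, the first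
derivative of the output, must stay `O(h²)` over `O(1/h)` steps. If the output vanishes at both ends
of a step, Taylor expansion gives `w1(b) + w1(a) = (h²/6) jerk + O(h³)`
(`Bounds.norm_w1_add_w1_le`). Thus `w1` flips sign around the slowly varying value `(h²/12) jerk`,
and the size of its deviation from that value is not amplified to leading order. Adding this
deviation, divided by `h`, to the state error gives the quantity `err`; `err + h` grows by at most a
factor `1 + O(h)` per step (`IsExact.exists_step`), and a discrete Grönwall argument shows that it
is `O(h)`.

For constant `μ`, the function `H + ⟨μ, g⟩` is a first integral; since `g` vanishes at both ends of
a step, `H` takes equal values there (`IsMotion.energy_eq`). -/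

theorem norm_prod_sub_le {Y L : Type*} [NormedAddCommGroup Y] [NormedAddCommGroup L]
    (y y' : Y) (mu mu' : L) :
    ‖(y, mu) - (y', mu')‖ ≤ ‖y - y'‖ + ‖mu - mu'‖ :=
  max_le (le_add_of_nonneg_right (norm_nonneg _)) (le_add_of_nonneg_left (norm_nonneg _))

theorem norm_prod_le_of_margin {Y L : Type*} [NormedAddCommGroup Y]
    [NormedAddCommGroup L] {ye : ℝ → Y} {lam : ℝ → L} {T R : ℝ}
    (hR : ∀ t ∈ Icc 0 T, ‖ye t‖ ≤ R - 2 ∧ ‖lam t‖ ≤ R - 2) :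
    ∀ t ∈ Icc 0 T, ‖(ye t, lam t)‖ ≤ R := fun t ht =>
  max_le (by have := (hR t ht).1; simp only; linarith)
    (by have := (hR t ht).2; simp only; linarith)

/-! ### Taylor, Grönwall, Picard-Lindelöf and compactness estimates. -/

section Calculus

variable {E F : Type*} [NormedAddCommGroup E] [NormedSpace ℝ E]
  [NormedAddCommGroup F] [NormedSpace ℝ F]

/-- A curve stays close to a comparison curve with the same starting point and a close
derivative. -/
theorem norm_sub_le_of_norm_deriv_sub_le {f f' P P' : ℝ → E} {a b ε : ℝ}
    (hf : ∀ t ∈ Icc a b, HasDerivWithinAt f (f' t) (Icc a b) t)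
    (hP : ∀ t ∈ Icc a b, HasDerivWithinAt P (P' t) (Icc a b) t) (h0 : P a = f a)
    (hb : ∀ t ∈ Icc a b, ‖f' t - P' t‖ ≤ ε) :
    ∀ t ∈ Icc a b, ‖f t - P t‖ ≤ ε * (t - a) := by
  intro t ht
  have := norm_image_sub_le_of_norm_deriv_le_segment' (f := fun t => f t - P t)
    (fun x hx => (hf x hx).sub (hP x hx)) (fun x hx => hb x (Ico_subset_Icc_self hx)) t ht
  simpa [h0] using this

/-- Second-order Taylor estimate on an interval from a bound on the oscillation of the second
derivative. -/
theorem taylor_two {f f1 f2 : ℝ → E} {a b ε : ℝ} (hab : a ≤ b)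
    (hf : ∀ t ∈ Icc a b, HasDerivWithinAt f (f1 t) (Icc a b) t)
    (hf1 : ∀ t ∈ Icc a b, HasDerivWithinAt f1 (f2 t) (Icc a b) t)
    (hb : ∀ t ∈ Icc a b, ‖f2 t - f2 a‖ ≤ ε) :
    (∀ t ∈ Icc a b, ‖f1 t - (f1 a + (t - a) • f2 a)‖ ≤ ε * (b - a)) ∧
    ∀ t ∈ Icc a b, ‖f t - (f a + (t - a) • f1 a + ((t - a) ^ 2 / 2) • f2 a)‖
      ≤ ε * (b - a) ^ 2 := by
  have hε : 0 ≤ ε := (norm_nonneg _).trans (hb a (left_mem_Icc.2 hab))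
  have h1 : ∀ t ∈ Icc a b, ‖f1 t - (f1 a + (t - a) • f2 a)‖ ≤ ε * (b - a) := by
    intro t ht
    refine (norm_sub_le_of_norm_deriv_sub_le (P := fun t => f1 a + (t - a) • f2 a)
      (P' := fun _ => f2 a) hf1 (fun s _ => ?_) (by simp) hb t ht).trans ?_
    · have h := (((hasDerivAt_id s).sub_const a).smul_const (f2 a)).const_add (f1 a)
      simpa using h.hasDerivWithinAt
    · exact mul_le_mul_of_nonneg_left (by linarith [ht.2]) hε
  refine ⟨h1, fun t ht => ?_⟩
  refine (norm_sub_le_of_norm_deriv_sub_le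
    (P := fun t => f a + (t - a) • f1 a + ((t - a) ^ 2 / 2) • f2 a)
    (P' := fun t => f1 a + (t - a) • f2 a) hf (fun s _ => ?_) (by simp) h1 t ht).trans ?_
  · have h := ((((hasDerivAt_id s).sub_const a).smul_const (f1 a)).const_add (f a)).add
      (((((hasDerivAt_id s).sub_const a).pow 2).div_const 2).smul_const (f2 a))
    have h' := h.hasDerivWithinAt (s := Icc a b)
    refine HasDerivWithinAt.congr_deriv (f := _) h' ?_
    simp
  · have : ε * (b - a) * (t - a) ≤ ε * (b - a) * (b - a) :=
      mul_le_mul_of_nonneg_left (by linarith [ht.2]) (mul_nonneg hε (by linarith))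
    linarith

/-- Third-order Taylor estimates on an interval for a function and its derivative. -/
theorem taylor_three {f f1 f2 f3 : ℝ → E} {a b ε : ℝ} (hab : a ≤ b)
    (hf : ∀ t ∈ Icc a b, HasDerivWithinAt f (f1 t) (Icc a b) t)
    (hf1 : ∀ t ∈ Icc a b, HasDerivWithinAt f1 (f2 t) (Icc a b) t)
    (hf2 : ∀ t ∈ Icc a b, HasDerivWithinAt f2 (f3 t) (Icc a b) t)
    (hb : ∀ t ∈ Icc a b, ‖f3 t - f3 a‖ ≤ ε) :
    (∀ t ∈ Icc a b, ‖f1 t - (f1 a + (t - a) • f2 a + ((t - a) ^ 2 / 2) • f3 a)‖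
      ≤ ε * (b - a) ^ 2) ∧
    ∀ t ∈ Icc a b, ‖f t - (f a + (t - a) • f1 a + ((t - a) ^ 2 / 2) • f2 a
      + ((t - a) ^ 3 / 6) • f3 a)‖ ≤ ε * (b - a) ^ 3 := by
  have hε : 0 ≤ ε := (norm_nonneg _).trans (hb a (left_mem_Icc.2 hab))
  have h1 := (taylor_two hab hf1 hf2 hb).2
  refine ⟨h1, fun t ht => ?_⟩
  refine (norm_sub_le_of_norm_deriv_sub_le
    (P := fun t => f a + (t - a) • f1 a + ((t - a) ^ 2 / 2) • f2 a + ((t - a) ^ 3 / 6) • f3 a)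
    (P' := fun t => f1 a + (t - a) • f2 a + ((t - a) ^ 2 / 2) • f3 a) hf (fun s _ => ?_)
    (by simp) h1 t ht).trans ?_
  · have h := (((((hasDerivAt_id s).sub_const a).smul_const (f1 a)).const_add (f a)).add
      (((((hasDerivAt_id s).sub_const a).pow 2).div_const 2).smul_const (f2 a))).add
      (((((hasDerivAt_id s).sub_const a).pow 3).div_const 6).smul_const (f3 a))
    have h' := h.hasDerivWithinAt (s := Icc a b)
    refine HasDerivWithinAt.congr_deriv (f := _) h' ?_
    simp only [id, Nat.cast_ofNat, mul_one, one_smul, Nat.add_one_sub_one, pow_one]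
    module
  · have : ε * (b - a) ^ 2 * (t - a) ≤ ε * (b - a) ^ 2 * (b - a) :=
      mul_le_mul_of_nonneg_left (by linarith [ht.2]) (by positivity)
    linarith

theorem hasDerivWithinAt_Ici_of_Icc {f : ℝ → E} {f' : E} {a b t : ℝ} (ht : t ∈ Ico a b)
    (h : HasDerivWithinAt f f' (Icc a b) t) : HasDerivWithinAt f f' (Ici t) t :=
  h.mono_of_mem_nhdsWithin (Icc_mem_nhdsGE_of_mem ht)

/-- Grönwall's inequality on a short interval, in linearized form. -/
theorem norm_le_of_norm_deriv_le_affine {f f' : ℝ → E} {a b K ε : ℝ} (hK : 0 < K)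
    (hKh : K * (b - a) ≤ 1) (hε : 0 ≤ ε)
    (hf : ∀ t ∈ Icc a b, HasDerivWithinAt f (f' t) (Icc a b) t)
    (hb : ∀ t ∈ Icc a b, ‖f' t‖ ≤ K * ‖f t‖ + ε) :
    ∀ t ∈ Icc a b, ‖f t‖ ≤ ‖f a‖ + 2 * (t - a) * (K * ‖f a‖ + ε) := by
  intro t ht
  have h := norm_le_gronwallBound_of_norm_deriv_right_le (f := f) (f' := f') (δ := ‖f a‖)
    (K := K) (ε := ε) (fun x hx => (hf x hx).continuousWithinAt)
    (fun x hx => hasDerivWithinAt_Ici_of_Icc hx (hf x (Ico_subset_Icc_self hx))) le_rfl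
    (fun x hx => hb x (Ico_subset_Icc_self hx)) t ht
  rw [gronwallBound_of_K_ne_0 hK.ne'] at h
  have hx0 : 0 ≤ K * (t - a) := mul_nonneg hK.le (by linarith [ht.1])
  have hx1 : K * (t - a) ≤ 1 := (mul_le_mul_of_nonneg_left (by linarith [ht.2]) hK.le).trans hKh
  have he : Real.exp (K * (t - a)) - 1 ≤ 2 * (K * (t - a)) := by
    have := Real.abs_exp_sub_one_le (x := K * (t - a)) (by rwa [abs_of_nonneg hx0])
    rw [abs_of_nonneg hx0] at this
    exact (le_abs_self _).trans this
  have h1 : ‖f a‖ * (Real.exp (K * (t - a)) - 1) ≤ ‖f a‖ * (2 * (K * (t - a))) :=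
    mul_le_mul_of_nonneg_left he (norm_nonneg _)
  have h2 : ε / K * (Real.exp (K * (t - a)) - 1) ≤ ε / K * (2 * (K * (t - a))) :=
    mul_le_mul_of_nonneg_left he (by positivity)
  have h3 : ε / K * (2 * (K * (t - a))) = 2 * (t - a) * ε := by field_simp
  linarith

/-- A curve whose speed is less than `K` as long as it is within distance `1` of its starting point
does not leave that neighbourhood before time `1 / K`. -/
theorem norm_sub_le_of_norm_deriv_lt_near {f f' : ℝ → E} {a b K : ℝ} (hK : 0 ≤ K)
    (hKh : K * (b - a) ≤ 1)
    (hf : ∀ t ∈ Icc a b, HasDerivWithinAt f (f' t) (Icc a b) t)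
    (hb : ∀ t ∈ Icc a b, ‖f t - f a‖ ≤ 1 → ‖f' t‖ < K) :
    ∀ t ∈ Icc a b, ‖f t - f a‖ ≤ K * (t - a) := by
  refine image_norm_le_of_norm_deriv_right_lt_deriv_boundary (f := fun t => f t - f a) (f' := f')
    (B := fun t => K * (t - a)) (B' := fun _ => K)
    (fun x hx => ((hf x hx).continuousWithinAt).sub continuousWithinAt_const) (fun x hx => ?_)
    (by simp) (fun x => ?_) (fun x hx h => ?_)
  · exact (hasDerivWithinAt_Ici_of_Icc hx (hf x (Ico_subset_Icc_self hx))).sub_const _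
  · simpa using ((hasDerivAt_id x).sub_const a).const_mul K
  · refine hb x (Ico_subset_Icc_self hx) ?_
    rw [h]
    exact (mul_le_mul_of_nonneg_left (by linarith [hx.2]) hK).trans hKh

/-- A `C¹` function on a finite-dimensional space is bounded and Lipschitz on balls. -/
theorem exists_bound_and_lipschitz [FiniteDimensional ℝ E] {Φ : E → F} (hΦ : ContDiff ℝ 1 Φ)
    (R : ℝ) : ∃ K : ℝ, 1 ≤ K ∧ (∀ x, ‖x‖ ≤ R → ‖Φ x‖ ≤ K) ∧
      ∀ x y, ‖x‖ ≤ R → ‖y‖ ≤ R → ‖Φ x - Φ y‖ ≤ K * ‖x - y‖ := by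
  have hc : IsCompact (Metric.closedBall (0 : E) R) := isCompact_closedBall 0 R
  obtain ⟨K1, h1⟩ := hc.exists_bound_of_continuousOn (hΦ.continuous.continuousOn)
  obtain ⟨K2, h2⟩ := hc.exists_bound_of_continuousOn
    ((hΦ.continuous_fderiv one_ne_zero).continuousOn)
  refine ⟨max 1 (max K1 K2), le_max_left _ _, fun x hx => ?_, fun x y hx hy => ?_⟩
  · exact (h1 x (by simpa using hx)).trans ((le_max_left _ _).trans (le_max_right _ _))
  · refine Convex.norm_image_sub_le_of_norm_fderiv_le
      (s := Metric.closedBall (0 : E) R) (fun z _ => (hΦ.differentiable one_ne_zero) z)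
      (fun z hz => (h2 z hz).trans ((le_max_right _ _).trans (le_max_right _ _)))
      (convex_closedBall _ _) (by simpa using hy) (by simpa using hx)

/-- Short-time existence with an explicit existence time. -/
theorem exists_solution_Icc [CompleteSpace E] {f : E → E} {x₀ : E} {a b K : ℝ} (hab : a ≤ b)
    (hK : 0 ≤ K) (hKh : K * (b - a) ≤ 1)
    (hbd : ∀ x, ‖x - x₀‖ ≤ 1 → ‖f x‖ ≤ K)
    (hlip : ∀ x y, ‖x - x₀‖ ≤ 1 → ‖y - x₀‖ ≤ 1 → ‖f x - f y‖ ≤ K * ‖x - y‖) :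
    ∃ y : ℝ → E, y a = x₀ ∧ ∀ t ∈ Icc a b, HasDerivWithinAt y (f (y t)) (Icc a b) t := by
  have h : IsPicardLindelof (fun _ : ℝ => f) (tmin := a) (tmax := b) ⟨a, left_mem_Icc.2 hab⟩ x₀
      1 0 ⟨K, hK⟩ ⟨K, hK⟩ := by
    refine IsPicardLindelof.of_time_independent (fun x hx => ?_)
      (LipschitzOnWith.of_dist_le_mul fun x hx y hy => ?_) ?_
    · exact hbd x (by simpa [dist_eq_norm] using hx)
    · rw [dist_eq_norm, dist_eq_norm]
      exact hlip x y (by simpa [dist_eq_norm] using hx) (by simpa [dist_eq_norm] using hy)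
    · change K * max (b - a) (a - a) ≤ 1 - 0
      simpa [hab] using hKh
  exact h.exists_eq_forall_mem_Icc_hasDerivWithinAt₀

/-- Along the zero set of `w`, injective endomorphisms depending continuously on the point are
uniformly bounded below on bounded sets. -/
theorem exists_uniform_lower_bound [FiniteDimensional ℝ E] [FiniteDimensional ℝ F]
    {w : E → F} (hw : Continuous w) {G : E → F →L[ℝ] F} (hG : Continuous G)
    (hinj : ∀ y, w y = 0 → Function.Injective (G y)) (R : ℝ) :
    ∃ K : ℝ, 1 ≤ K ∧ ∀ y, ‖y‖ ≤ R → w y = 0 → ∀ l, ‖l‖ ≤ K * ‖G y l‖ := by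
  set S : Set (E × F) := (Metric.closedBall 0 R ∩ {y | w y = 0}) ×ˢ Metric.sphere 0 1 with hS
  have hcS : IsCompact S :=
    ((isCompact_closedBall _ _).inter_right (isClosed_eq hw continuous_const)).prod
      (isCompact_sphere _ _)
  have hcont : Continuous fun x : E × F => ‖G x.1 x.2‖ := by fun_prop
  have key : ∃ c : ℝ, 0 < c ∧ ∀ x ∈ S, c ≤ ‖G x.1 x.2‖ := by
    rcases S.eq_empty_or_nonempty with he | hne
    -- The compact set may be empty (no zero of `w` in the ball, or a trivial space); any positive
    -- constant then serves.
    · exact ⟨1, one_pos, by simp [he]⟩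
    · obtain ⟨x, hx, hmin⟩ := hcS.exists_isMinOn hne hcont.continuousOn
      refine ⟨_, norm_pos_iff.2 fun h0 => ?_, fun z hz => hmin hz⟩
      have : x.2 = 0 := hinj x.1 hx.1.2 (by simpa using h0)
      simpa [this] using hx.2
  obtain ⟨c, hc, hmin⟩ := key
  refine ⟨max 1 c⁻¹, le_max_left _ _, fun y hy hwy l => ?_⟩
  rcases eq_or_ne l 0 with rfl | hl
  · simp
  have hl' : 0 < ‖l‖ := norm_pos_iff.2 hl
  have h := hmin (y, ‖l‖⁻¹ • l) ⟨⟨by simpa using hy, hwy⟩, by simp [norm_smul, hl'.ne']⟩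
  simp only [map_smul, norm_smul, norm_inv, norm_norm] at h
  have h2 : c * ‖l‖ ≤ ‖G y l‖ := by
    calc c * ‖l‖ ≤ ‖l‖⁻¹ * ‖G y l‖ * ‖l‖ := by gcongr
      _ = ‖G y l‖ := by field_simp
  calc ‖l‖ = c⁻¹ * (c * ‖l‖) := by field_simp
    _ ≤ max 1 c⁻¹ * ‖G y l‖ := by gcongr; exact le_max_right _ _

/-- The deviation from a slowly varying multiple of `J` is preserved in norm, up to small terms,
when a quantity alternates in sign. -/
theorem norm_sub_smul_le_of_norm_add_sub_smul_le {w w' j J J' : E} {c A B D : ℝ} (hc : 0 ≤ c)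
    (h1 : ‖w' + w - (2 * c) • j‖ ≤ A) (h2 : ‖j - J‖ ≤ B) (h3 : ‖J - J'‖ ≤ D) :
    ‖w' - c • J'‖ ≤ ‖w - c • J‖ + A + 2 * c * B + c * D := by
  -- The old deviation `w - c • J` enters with coefficient exactly `-1`, so its norm is carried over
  -- with no amplification factor.
  have hid : w' - c • J' = (w' + w - (2 * c) • j) + (2 * c) • (j - J) + c • (J - J')
      - (w - c • J) := by module
  rw [hid]
  refine (norm_sub_le _ _).trans ?_
  have h4 : ‖(2 * c) • (j - J)‖ ≤ 2 * c * B := by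
    rw [norm_smul, Real.norm_of_nonneg (by positivity)]
    gcongr
  have h5 : ‖c • (J - J')‖ ≤ c * D := by
    rw [norm_smul, Real.norm_of_nonneg hc]
    gcongr
  have h6 := norm_add₃_le (a := w' + w - (2 * c) • j) (b := (2 * c) • (j - J))
    (c := c • (J - J'))
  linarith

end Calculus

/-! ### Output systems and their motions over one short step. -/

/-- A control system `y' = f (y, μ)` with output `w0`, whose second derivative `acc` along motions
is the first one that involves the control `μ`; it depends on `μ` in an affine way, with linear
part `-G`, which is injective along the zero set of the output. -/
structure OutputSystem (Y L : Type*) [NormedAddCommGroup Y] [NormedSpace ℝ Y]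
    [NormedAddCommGroup L] [NormedSpace ℝ L] where
  /-- the controlled vector field -/
  f : Y × L → Y
  /-- the output -/
  w0 : Y → L
  /-- the first derivative of the output along motions -/
  w1 : Y → L
  /-- the second derivative of the output along motions with constant control -/
  acc : Y × L → L
  /-- the sensitivity of the second derivative to the control -/
  G : Y → L →L[ℝ] L
  contDiff_f : ContDiff ℝ 1 f
  differentiable_w0 : Differentiable ℝ w0
  differentiable_w1 : Differentiable ℝ w1
  contDiff_acc : ContDiff ℝ 2 acc
  continuous_G : Continuous G
  fderiv_w0 : ∀ y mu, fderiv ℝ w0 y (f (y, mu)) = w1 y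
  fderiv_w1 : ∀ y mu, fderiv ℝ w1 y (f (y, mu)) = acc (y, mu)
  acc_sub : ∀ y mu mu', acc (y, mu) - acc (y, mu') = -G y (mu - mu')
  injective_G : ∀ y, w0 y = 0 → Function.Injective (G y)

namespace OutputSystem

variable {Y L : Type*} [NormedAddCommGroup Y] [NormedSpace ℝ Y]
  [NormedAddCommGroup L] [NormedSpace ℝ L] (S : OutputSystem Y L)

/-- The third derivative of the output along motions with constant control. -/
def jerk (x : Y × L) : L := fderiv ℝ S.acc x (S.f x, 0)

theorem contDiff_jerk : ContDiff ℝ 1 S.jerk :=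
  (S.contDiff_acc.fderiv_right (m := 1) (by norm_num)).clm_apply
    (S.contDiff_f.prodMk contDiff_const)

/-- `y` is a motion on `[a, b]` with constant control `mu`. -/
def IsFlow (a b : ℝ) (mu : L) (y : ℝ → Y) : Prop :=
  ∀ t ∈ Icc a b, HasDerivWithinAt y (S.f (y t, mu)) (Icc a b) t

/-- `K` bounds the data of the system, and their Lipschitz constants, on the ball of radius `R`. -/
structure Bounds (R K : ℝ) : Prop where
  one_le : 1 ≤ K
  f_lt : ∀ x, ‖x‖ ≤ R → ‖S.f x‖ < K
  f_lip : ∀ x x', ‖x‖ ≤ R → ‖x'‖ ≤ R → ‖S.f x - S.f x'‖ ≤ K * ‖x - x'‖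
  acc_lip : ∀ x x', ‖x‖ ≤ R → ‖x'‖ ≤ R → ‖S.acc x - S.acc x'‖ ≤ K * ‖x - x'‖
  jerk_le : ∀ x, ‖x‖ ≤ R → ‖S.jerk x‖ ≤ K
  jerk_lip : ∀ x x', ‖x‖ ≤ R → ‖x'‖ ≤ R → ‖S.jerk x - S.jerk x'‖ ≤ K * ‖x - x'‖
  le_G : ∀ y, ‖y‖ ≤ R → S.w0 y = 0 → ∀ l, ‖l‖ ≤ K * ‖S.G y l‖

theorem exists_bounds [FiniteDimensional ℝ Y] [FiniteDimensional ℝ L] (R : ℝ) :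
    ∃ K, S.Bounds R K := by
  obtain ⟨K1, h1, hb1, hl1⟩ := exists_bound_and_lipschitz S.contDiff_f R
  obtain ⟨K2, h2, -, hl2⟩ :=
    exists_bound_and_lipschitz (S.contDiff_acc.of_le (m := 1) (by norm_num)) R
  obtain ⟨K3, h3, hb3, hl3⟩ := exists_bound_and_lipschitz S.contDiff_jerk R
  obtain ⟨K4, h4, hb4⟩ := exists_uniform_lower_bound S.differentiable_w0.continuous S.continuous_G
    S.injective_G R
  have e1 : K1 ≤ K1 + K2 + K3 + K4 := by linarith
  have e2 : K2 ≤ K1 + K2 + K3 + K4 := by linarith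
  have e3 : K3 ≤ K1 + K2 + K3 + K4 := by linarith
  have e4 : K4 ≤ K1 + K2 + K3 + K4 := by linarith
  refine ⟨K1 + K2 + K3 + K4, by linarith, fun x hx => ?_, fun x x' hx hx' => ?_,
    fun x x' hx hx' => ?_, fun x hx => ?_, fun x x' hx hx' => ?_, fun y hy hwy l => ?_⟩
  · exact (hb1 x hx).trans_lt (by linarith)
  · exact (hl1 x x' hx hx').trans (mul_le_mul_of_nonneg_right e1 (norm_nonneg _))
  · exact (hl2 x x' hx hx').trans (mul_le_mul_of_nonneg_right e2 (norm_nonneg _))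
  · exact (hb3 x hx).trans e3
  · exact (hl3 x x' hx hx').trans (mul_le_mul_of_nonneg_right e3 (norm_nonneg _))
  · exact (hb4 y hy hwy l).trans (mul_le_mul_of_nonneg_right e4 (norm_nonneg _))

variable {S} {R K a b : ℝ} {mu mu' : L} {y y' : ℝ → Y}

theorem Bounds.pos (B : S.Bounds R K) : 0 < K := one_pos.trans_le B.one_le

theorem IsFlow.deriv_w0 (hy : S.IsFlow a b mu y) :
    ∀ t ∈ Icc a b, HasDerivWithinAt (fun t => S.w0 (y t)) (S.w1 (y t)) (Icc a b) t := by
  intro t ht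
  have := (S.differentiable_w0 (y t)).hasFDerivAt.comp_hasDerivWithinAt t (hy t ht)
  rwa [S.fderiv_w0] at this

theorem IsFlow.deriv_w1 (hy : S.IsFlow a b mu y) :
    ∀ t ∈ Icc a b, HasDerivWithinAt (fun t => S.w1 (y t)) (S.acc (y t, mu)) (Icc a b) t := by
  intro t ht
  have := (S.differentiable_w1 (y t)).hasFDerivAt.comp_hasDerivWithinAt t (hy t ht)
  rwa [S.fderiv_w1] at this

theorem IsFlow.deriv_acc (hy : S.IsFlow a b mu y) :
    ∀ t ∈ Icc a b,
      HasDerivWithinAt (fun t => S.acc (y t, mu)) (S.jerk (y t, mu)) (Icc a b) t := by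
  intro t ht
  exact ((S.contDiff_acc.differentiable two_ne_zero) (y t, mu)).hasFDerivAt.comp_hasDerivWithinAt t
    ((hy t ht).prodMk (hasDerivWithinAt_const t _ mu))

/-- A continuity argument: within distance `1` of its start the state lies in the ball of radius
`R`, where the speed is strictly below `K`, so it cannot leave that neighbourhood before time `1 /
K`. -/
theorem Bounds.norm_sub_le_of_isFlow (B : S.Bounds R K) (hKh : K * (b - a) ≤ 1)
    (ha : ‖y a‖ ≤ R - 1) (hmu : ‖mu‖ ≤ R) (hy : S.IsFlow a b mu y) :
    ∀ t ∈ Icc a b, ‖y t - y a‖ ≤ K * (t - a) := by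
  refine norm_sub_le_of_norm_deriv_lt_near B.pos.le hKh hy fun t _ h => ?_
  refine B.f_lt _ (max_le ?_ hmu)
  have := norm_le_norm_sub_add (y t) (y a)
  simp only
  linarith

theorem Bounds.norm_le_of_isFlow (B : S.Bounds R K) (hKh : K * (b - a) ≤ 1)
    (ha : ‖y a‖ ≤ R - 1) (hmu : ‖mu‖ ≤ R) (hy : S.IsFlow a b mu y) :
    ∀ t ∈ Icc a b, ‖(y t, mu)‖ ≤ R := by
  intro t ht
  have h1 := B.norm_sub_le_of_isFlow hKh ha hmu hy t ht
  have h2 := norm_le_norm_sub_add (y t) (y a)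
  have h3 : K * (t - a) ≤ K * (b - a) := mul_le_mul_of_nonneg_left (by linarith [ht.2]) B.pos.le
  exact max_le (by simp only; linarith) hmu

theorem Bounds.exists_isFlow [CompleteSpace Y] (B : S.Bounds R K) (hab : a ≤ b)
    (hKh : K * (b - a) ≤ 1) {y₀ : Y} (ha : ‖y₀‖ ≤ R - 1) (hmu : ‖mu‖ ≤ R) :
    ∃ y, y a = y₀ ∧ S.IsFlow a b mu y := by
  have hR : ∀ x, ‖x - y₀‖ ≤ 1 → ‖(x, mu)‖ ≤ R := fun x hx =>
    max_le (by have := norm_le_norm_sub_add x y₀; simp only; linarith) hmu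
  refine exists_solution_Icc (f := fun x => S.f (x, mu)) hab B.pos.le hKh
    (fun x hx => (B.f_lt _ (hR x hx)).le) fun x z hx hz => ?_
  simpa [Prod.norm_def] using B.f_lip _ _ (hR x hx) (hR z hz)

/-- Dependence of a motion on the constant control. -/
theorem Bounds.norm_sub_le_of_isFlow_isFlow (B : S.Bounds R K) (hKh : K * (b - a) ≤ 1)
    (ha : ‖y a‖ ≤ R - 1) (haa : y' a = y a) (hmu : ‖mu‖ ≤ R) (hmu' : ‖mu'‖ ≤ R)
    (hy : S.IsFlow a b mu y) (hy' : S.IsFlow a b mu' y') :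
    ∀ t ∈ Icc a b, ‖y t - y' t‖ ≤ 2 * ‖mu - mu'‖ := by
  intro t ht
  have h := norm_le_of_norm_deriv_le_affine (f := fun t => y t - y' t) B.pos hKh
    (ε := K * ‖mu - mu'‖) (by have := B.pos; positivity)
    (fun s hs => (hy s hs).sub (hy' s hs)) (fun s hs => ?_) t ht
  · simp only [haa, sub_self, norm_zero, mul_zero, zero_add] at h
    have h3 : K * (t - a) ≤ K * (b - a) := mul_le_mul_of_nonneg_left (by linarith [ht.2]) B.pos.le
    have h4 : K * (t - a) * ‖mu - mu'‖ ≤ 1 * ‖mu - mu'‖ :=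
      mul_le_mul_of_nonneg_right (h3.trans hKh) (norm_nonneg _)
    linarith
  · rw [← mul_add]
    exact (B.f_lip _ _ (B.norm_le_of_isFlow hKh ha hmu hy s hs)
      (B.norm_le_of_isFlow hKh (haa ▸ ha) hmu' hy' s hs)).trans
      (mul_le_mul_of_nonneg_left (norm_prod_sub_le _ _ _ _) B.pos.le)

/-- Dependence of the final output on the constant control. -/
theorem Bounds.norm_shooting_le (B : S.Bounds R K) (hab : a ≤ b) (hKh : K * (b - a) ≤ 1)
    (ha : ‖y a‖ ≤ R - 1) (haa : y' a = y a) (hmu : ‖mu‖ ≤ R) (hmu' : ‖mu'‖ ≤ R)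
    (hy : S.IsFlow a b mu y) (hy' : S.IsFlow a b mu' y') :
    ‖S.w0 (y b) - S.w0 (y' b) + ((b - a) ^ 2 / 2) • S.G (y a) (mu - mu')‖
      ≤ 2 * K * ‖mu - mu'‖ * (b - a) ^ 3 := by
  -- Expanding the difference of the two outputs, rather than each one separately, keeps the factor
  -- `‖mu - mu'‖` in the remainder, as contraction and uniqueness require.
  have hosc : ∀ t ∈ Icc a b, ‖(S.acc (y t, mu) - S.acc (y' t, mu'))
      - (S.acc (y a, mu) - S.acc (y' a, mu'))‖ ≤ 2 * K * ‖mu - mu'‖ * (b - a) := by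
    intro t ht
    refine (norm_image_sub_le_of_norm_deriv_le_segment'
      (f := fun t => S.acc (y t, mu) - S.acc (y' t, mu')) (C := 2 * K * ‖mu - mu'‖)
      (fun s hs => (hy.deriv_acc s hs).sub (hy'.deriv_acc s hs)) (fun s hs => ?_) t ht).trans ?_
    · have hs' := Ico_subset_Icc_self hs
      refine (B.jerk_lip _ _ (B.norm_le_of_isFlow hKh ha hmu hy s hs')
        (B.norm_le_of_isFlow hKh (haa ▸ ha) hmu' hy' s hs')).trans ?_
      have : ‖(y s, mu) - (y' s, mu')‖ ≤ 2 * ‖mu - mu'‖ :=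
        max_le (B.norm_sub_le_of_isFlow_isFlow hKh ha haa hmu hmu' hy hy' s hs')
          (by change ‖mu - mu'‖ ≤ _; linarith [norm_nonneg (mu - mu')])
      nlinarith [B.pos]
    · have := B.pos
      exact mul_le_mul_of_nonneg_left (by linarith [ht.2]) (by positivity)
  have h := (taylor_two hab (f := fun t => S.w0 (y t) - S.w0 (y' t))
    (f1 := fun t => S.w1 (y t) - S.w1 (y' t))
    (f2 := fun t => S.acc (y t, mu) - S.acc (y' t, mu'))
    (fun s hs => (hy.deriv_w0 s hs).sub (hy'.deriv_w0 s hs))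
    (fun s hs => (hy.deriv_w1 s hs).sub (hy'.deriv_w1 s hs)) hosc).2 b (right_mem_Icc.2 hab)
  simp only [haa, sub_self, smul_zero, add_zero, zero_add, S.acc_sub, smul_neg,
    sub_neg_eq_add] at h
  linarith

/-- Second-order expansion of the final output. -/
theorem Bounds.norm_taylor_w0_le (B : S.Bounds R K) (hab : a ≤ b) (hKh : K * (b - a) ≤ 1)
    (ha : ‖y a‖ ≤ R - 1) (hmu : ‖mu‖ ≤ R) (hy : S.IsFlow a b mu y) :
    ‖S.w0 (y b) - (S.w0 (y a) + (b - a) • S.w1 (y a) + ((b - a) ^ 2 / 2) • S.acc (y a, mu))‖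
      ≤ K * (b - a) ^ 3 := by
  have h := (taylor_two hab hy.deriv_w0 hy.deriv_w1 (ε := K * (b - a)) (fun t ht => ?_)).2 b
    (right_mem_Icc.2 hab)
  · linarith
  · refine (norm_image_sub_le_of_norm_deriv_le_segment' hy.deriv_acc (C := K)
      (fun s hs => B.jerk_le _ (B.norm_le_of_isFlow hKh ha hmu hy s (Ico_subset_Icc_self hs)))
      t ht).trans (mul_le_mul_of_nonneg_left (by linarith [ht.2]) B.pos.le)

/-- If the output vanishes at both ends, its derivatives there are opposite up to an explicit
second-order term. -/
theorem Bounds.norm_w1_add_w1_le (B : S.Bounds R K) (hab : a < b) (hKh : K * (b - a) ≤ 1)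
    (ha : ‖y a‖ ≤ R - 1) (hmu : ‖mu‖ ≤ R) (hy : S.IsFlow a b mu y)
    (h0 : S.w0 (y a) = 0) (h1 : S.w0 (y b) = 0) :
    ‖S.w1 (y b) + S.w1 (y a) - ((b - a) ^ 2 / 6) • S.jerk (y a, mu)‖
      ≤ 3 * K ^ 2 * (b - a) ^ 3 := by
  have hh : 0 < b - a := sub_pos.2 hab
  have hosc : ∀ t ∈ Icc a b, ‖S.jerk (y t, mu) - S.jerk (y a, mu)‖ ≤ K ^ 2 * (b - a) := by
    intro t ht
    refine (B.jerk_lip _ _ (B.norm_le_of_isFlow hKh ha hmu hy t ht)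
      (B.norm_le_of_isFlow hKh ha hmu hy a (left_mem_Icc.2 hab.le))).trans ?_
    refine (mul_le_mul_of_nonneg_left (norm_prod_sub_le _ _ _ _) B.pos.le).trans ?_
    rw [sub_self, norm_zero, add_zero, pow_two, mul_assoc]
    exact mul_le_mul_of_nonneg_left ((B.norm_sub_le_of_isFlow hKh ha hmu hy t ht).trans
      (mul_le_mul_of_nonneg_left (by linarith [ht.2]) B.pos.le)) B.pos.le
  obtain ⟨t1, t0⟩ := taylor_three hab.le hy.deriv_w0 hy.deriv_w1 hy.deriv_acc hosc
  have t1 := t1 b (right_mem_Icc.2 hab.le)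
  have t0 := t0 b (right_mem_Icc.2 hab.le)
  simp only [h0, h1] at t0
  set h := b - a with hdef
  set r1 := S.w1 (y b) - (S.w1 (y a) + h • S.acc (y a, mu) + (h ^ 2 / 2) • S.jerk (y a, mu))
  set r0 := (0 : L) - (0 + h • S.w1 (y a) + (h ^ 2 / 2) • S.acc (y a, mu)
    + (h ^ 3 / 6) • S.jerk (y a, mu)) with hr0
  -- The weight `2 / h` eliminates the acceleration between the two Taylor expansions; the jerk
  -- keeps the coefficient `1/2 - 1/3 = 1/6`.
  have key : S.w1 (y b) + S.w1 (y a) - (h ^ 2 / 6) • S.jerk (y a, mu) = r1 - (2 / h) • r0 := by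
    simp only [r1, r0]
    match_scalars <;> field_simp <;> ring
  rw [key]
  refine (norm_sub_le _ _).trans ?_
  rw [norm_smul, Real.norm_of_nonneg (by positivity)]
  have : 2 / h * ‖r0‖ ≤ 2 / h * (K ^ 2 * h * h ^ 3) :=
    mul_le_mul_of_nonneg_left t0 (by positivity)
  have e : 2 / h * (K ^ 2 * h * h ^ 3) = 2 * K ^ 2 * h ^ 3 := by field_simp
  linarith

/-- Any control that steers the output back to zero is close to every reference control for which
the acceleration of the output is small. -/
theorem Bounds.norm_control_sub_le (B : S.Bounds R K) (hab : a < b) (hKh : K * (b - a) ≤ 1)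
    (ha : ‖y a‖ ≤ R - 1) (hmu : ‖mu‖ ≤ R) (hy : S.IsFlow a b mu y)
    (h0 : S.w0 (y a) = 0) (h1 : S.w0 (y b) = 0) (ref : L) :
    ‖mu - ref‖ ≤ K * (2 / (b - a) * ‖S.w1 (y a)‖ + ‖S.acc (y a, ref)‖ + 2 * K * (b - a)) := by
  have hh : 0 < b - a := sub_pos.2 hab
  have hR : ‖y a‖ ≤ R := by linarith
  refine (B.le_G (y a) hR h0 _).trans (mul_le_mul_of_nonneg_left ?_ B.pos.le)
  have h := B.norm_taylor_w0_le hab.le hKh ha hmu hy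
  rw [h0, h1] at h
  set h' := b - a
  set r := (0 : L) - (0 + h' • S.w1 (y a) + (h' ^ 2 / 2) • S.acc (y a, mu))
  -- With the output zero at both ends, the Taylor expansion can be solved for `acc (y a, mu)`.
  have hG : S.G (y a) (mu - ref) = (2 / h' ^ 2) • r + (2 / h') • S.w1 (y a)
      + S.acc (y a, ref) := by
    have hs := S.acc_sub (y a) mu ref
    have : S.G (y a) (mu - ref) = S.acc (y a, ref) - S.acc (y a, mu) := by
      rw [← neg_sub (S.acc (y a, mu)), hs, neg_neg]
    rw [this]
    simp only [r]
    match_scalars <;> field_simp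
    ring
  rw [hG]
  refine (norm_add₃_le).trans ?_
  rw [norm_smul, norm_smul, Real.norm_of_nonneg (by positivity),
    Real.norm_of_nonneg (by positivity)]
  have : 2 / h' ^ 2 * ‖r‖ ≤ 2 / h' ^ 2 * (K * h' ^ 3) :=
    mul_le_mul_of_nonneg_left h (by positivity)
  have e : 2 / h' ^ 2 * (K * h' ^ 3) = 2 * K * h' := by field_simp
  linarith

/-- The control that steers the output back to zero is unique within a given bound, if the step is
short. -/
theorem Bounds.control_unique (B : S.Bounds R K) (hab : a < b) (hKh : 8 * K ^ 2 * (b - a) ≤ 1)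
    (ha : ‖y a‖ ≤ R - 1) (haa : y' a = y a) (hmu : ‖mu‖ ≤ R) (hmu' : ‖mu'‖ ≤ R)
    (hy : S.IsFlow a b mu y) (hy' : S.IsFlow a b mu' y') (h0 : S.w0 (y a) = 0)
    (h1 : S.w0 (y b) = 0) (h1' : S.w0 (y' b) = 0) : mu = mu' ∧ y b = y' b := by
  have hh : 0 < b - a := sub_pos.2 hab
  have hK := B.one_le
  have hKh' : K * (b - a) ≤ 1 := by nlinarith
  have h := B.norm_shooting_le hab.le hKh' ha haa hmu hmu' hy hy'
  have hG := B.le_G (y a) (by linarith) h0 (mu - mu')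
  rw [h1, h1', sub_self, zero_add, norm_smul, Real.norm_of_nonneg (by positivity)] at h
  set h' := b - a
  have h2 : ‖S.G (y a) (mu - mu')‖ ≤ 4 * K * h' * ‖mu - mu'‖ := by
    have h3 : h' ^ 2 / 2 * ‖S.G (y a) (mu - mu')‖ ≤ h' ^ 2 / 2 * (4 * K * h' * ‖mu - mu'‖) := by
      linarith
    exact le_of_mul_le_mul_left h3 (by positivity)
  -- Since `8 K² h' ≤ 1`, the right-hand side is at most half of the left, which forces both to
  -- vanish.
  have h4 : ‖mu - mu'‖ ≤ K * (4 * K * h' * ‖mu - mu'‖) :=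
    hG.trans (mul_le_mul_of_nonneg_left h2 B.pos.le)
  have h5 : 8 * K ^ 2 * h' * ‖mu - mu'‖ ≤ 1 * ‖mu - mu'‖ :=
    mul_le_mul_of_nonneg_right hKh (norm_nonneg _)
  have h6 : ‖mu - mu'‖ = 0 := le_antisymm (by linarith) (norm_nonneg _)
  refine ⟨sub_eq_zero.1 (norm_eq_zero.1 h6), ?_⟩
  have h7 := B.norm_sub_le_of_isFlow_isFlow hKh' ha haa hmu hmu' hy hy' b (right_mem_Icc.2 hab.le)
  rw [h6, mul_zero] at h7
  exact sub_eq_zero.1 (norm_eq_zero.1 (le_antisymm h7 (norm_nonneg _)))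

/-- Existence of a control that steers the output back to zero in a short step. -/
theorem Bounds.exists_control [FiniteDimensional ℝ Y] [FiniteDimensional ℝ L]
    (B : S.Bounds R K) (hab : a < b) (hKh : 8 * K ^ 2 * (b - a) ≤ 1) {y₀ : Y}
    (ha : ‖y₀‖ ≤ R - 1) (h0 : S.w0 y₀ = 0) {ref : L} (href : ‖ref‖ ≤ R - 1)
    (hsmall : K * (2 / (b - a) * ‖S.w1 y₀‖ + ‖S.acc (y₀, ref)‖ + 2 * K * (b - a)) ≤ 1 / 2) :
    ∃ mu y, ‖mu - ref‖ ≤ 1 ∧ y a = y₀ ∧ S.IsFlow a b mu y ∧ S.w0 (y b) = 0 := by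
  have := FiniteDimensional.complete ℝ Y
  have := FiniteDimensional.complete ℝ L
  have hh : 0 < b - a := sub_pos.2 hab
  have hK := B.one_le
  have hKh' : K * (b - a) ≤ 1 := by nlinarith
  have hball : ∀ mu, ‖mu - ref‖ ≤ 1 → ‖mu‖ ≤ R := fun mu h => by
    have := norm_le_norm_sub_add mu ref
    linarith
  -- The implication makes the choice of a motion total in `mu`; outside the unit ball around `ref`
  -- the value is arbitrary.
  have hex : ∀ mu : L, ∃ y : ℝ → Y, ‖mu - ref‖ ≤ 1 → y a = y₀ ∧ S.IsFlow a b mu y := fun mu => by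
    by_cases h : ‖mu - ref‖ ≤ 1
    · obtain ⟨y, hy⟩ := B.exists_isFlow hab.le hKh' ha (hball mu h)
      exact ⟨y, fun _ => hy⟩
    · exact ⟨0, fun h' => absurd h' h⟩
  choose sol hsol using hex
  have hsurj : ∀ l, ∃ l', S.G y₀ l' = l := fun l =>
    (LinearMap.injective_iff_surjective (f := (S.G y₀ : L →ₗ[ℝ] L))).1 (S.injective_G y₀ h0) l
  choose inv hinv using hsurj
  set h := b - a with hdef
  -- Newton's map for `mu ↦ S.w0 (sol mu b)` with the derivative frozen at its leading part `-(h²/2)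
  -- G(y₀)`.
  set Φ : L → L := fun mu => mu + inv ((2 / h ^ 2) • S.w0 (sol mu b)) with hΦ
  have hy₀R : ‖y₀‖ ≤ R := by linarith
  have hlip : ∀ mu mu', ‖mu - ref‖ ≤ 1 → ‖mu' - ref‖ ≤ 1 →
      ‖Φ mu - Φ mu'‖ ≤ 1 / 2 * ‖mu - mu'‖ := by
    intro mu mu' hm hm'
    obtain ⟨ha1, hf1⟩ := hsol mu hm
    obtain ⟨ha2, hf2⟩ := hsol mu' hm'
    have hs := B.norm_shooting_le hab.le hKh' (by rwa [ha1]) (ha2.trans ha1.symm) (hball mu hm)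
      (hball mu' hm') hf1 hf2
    rw [ha1] at hs
    have hG : S.G y₀ (Φ mu - Φ mu') = (2 / h ^ 2) •
        (S.w0 (sol mu b) - S.w0 (sol mu' b) + (h ^ 2 / 2) • S.G y₀ (mu - mu')) := by
      simp only [hΦ, map_sub, map_add, hinv]
      match_scalars <;> field_simp
    have hl := B.le_G y₀ hy₀R h0 (Φ mu - Φ mu')
    rw [hG, norm_smul, Real.norm_of_nonneg (by positivity)] at hl
    refine hl.trans ?_
    calc _ ≤ K * (2 / h ^ 2 * (2 * K * ‖mu - mu'‖ * h ^ 3)) := by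
          have := B.pos
          gcongr
      _ = 1 / 2 * ((8 * K ^ 2 * h) * ‖mu - mu'‖) := by field_simp; ring
      _ ≤ 1 / 2 * (1 * ‖mu - mu'‖) := by gcongr
      _ = _ := by ring
  -- Moving the centre by at most `1/2` and contracting by `1/2`, `Φ` maps the unit ball around
  -- `ref` to itself.
  have hcenter : ‖Φ ref - ref‖ ≤ 1 / 2 := by
    obtain ⟨ha1, hf1⟩ := hsol ref (by simp)
    have ht := B.norm_taylor_w0_le hab.le hKh' (by rwa [ha1]) (hball ref (by simp)) hf1
    rw [ha1, h0] at ht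
    have hl := B.le_G y₀ hy₀R h0 (Φ ref - ref)
    simp only [hΦ, add_sub_cancel_left, hinv] at hl
    simp only [hΦ, add_sub_cancel_left]
    refine hl.trans (le_trans (mul_le_mul_of_nonneg_left ?_ B.pos.le) hsmall)
    set r := S.w0 (sol ref b) - (0 + h • S.w1 y₀ + (h ^ 2 / 2) • S.acc (y₀, ref)) with hr
    have e : (2 / h ^ 2) • S.w0 (sol ref b)
        = (2 / h ^ 2) • r + (2 / h) • S.w1 y₀ + S.acc (y₀, ref) := by
      simp only [hr]
      match_scalars <;> field_simp <;> ring
    rw [e]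
    refine (norm_add₃_le).trans ?_
    rw [norm_smul, norm_smul, Real.norm_of_nonneg (by positivity),
      Real.norm_of_nonneg (by positivity)]
    have h1 : 2 / h ^ 2 * ‖r‖ ≤ 2 / h ^ 2 * (K * h ^ 3) :=
      mul_le_mul_of_nonneg_left ht (by positivity)
    have h2 : 2 / h ^ 2 * (K * h ^ 3) = 2 * K * h := by field_simp
    linarith
  have hmaps : MapsTo Φ (Metric.closedBall ref 1) (Metric.closedBall ref 1) := by
    intro mu hm
    rw [mem_closedBall_iff_norm] at hm ⊢
    have h1 := hlip mu ref hm (by simp)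
    have h2 := norm_sub_le_norm_sub_add_norm_sub (Φ mu) (Φ ref) ref
    linarith
  have hcontr : ContractingWith (1 / 2 : NNReal) (hmaps.restrict Φ _ _) := by
    refine ⟨by rw [← NNReal.coe_lt_coe]; norm_num, LipschitzWith.of_dist_le_mul fun x z => ?_⟩
    have := hlip x z (mem_closedBall_iff_norm.1 x.2) (mem_closedBall_iff_norm.1 z.2)
    simpa [Subtype.dist_eq, dist_eq_norm] using this
  obtain ⟨mu, hm, hfix, -⟩ := ContractingWith.exists_fixedPoint'
    Metric.isClosed_closedBall.isComplete hmaps hcontr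
    (Metric.mem_closedBall_self zero_le_one) (edist_ne_top _ _)
  rw [mem_closedBall_iff_norm] at hm
  refine ⟨mu, sol mu, hm, (hsol mu hm).1, (hsol mu hm).2, ?_⟩
  have h1 : inv ((2 / h ^ 2) • S.w0 (sol mu b)) = 0 := by
    have : Φ mu = mu := hfix
    simpa [hΦ] using this
  have h2 := hinv ((2 / h ^ 2) • S.w0 (sol mu b))
  rw [h1, map_zero] at h2
  exact (smul_eq_zero.1 h2.symm).resolve_left (by positivity)

end OutputSystem

/-! ### Comparison with the exact motion: error propagation and convergence. -/

namespace OutputSystem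

variable {Y L : Type*} [NormedAddCommGroup Y] [NormedSpace ℝ Y]
  [NormedAddCommGroup L] [NormedSpace ℝ L]

/-- `ye`, with the control `lam`, is a motion on `[0, T]` along which the output vanishes. -/
structure IsExact (S : OutputSystem Y L) (T : ℝ) (ye : ℝ → Y) (lam : ℝ → L) : Prop where
  deriv : ∀ t ∈ Icc 0 T, HasDerivWithinAt ye (S.f (ye t, lam t)) (Icc 0 T) t
  output : ∀ t ∈ Icc 0 T, S.w0 (ye t) = 0

variable {S : OutputSystem Y L} {T R K : ℝ} {ye : ℝ → Y} {lam : ℝ → L}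

/-- Differentiate the vanishing output; `0 < T` makes one-sided derivatives on the interval unique.
-/
theorem IsExact.w1_eq_zero (hT : 0 < T) (hex : S.IsExact T ye lam) :
    ∀ t ∈ Icc 0 T, S.w1 (ye t) = 0 := by
  intro t ht
  have h := (S.differentiable_w0 (ye t)).hasFDerivAt.comp_hasDerivWithinAt t (hex.deriv t ht)
  rw [S.fderiv_w0] at h
  exact (uniqueDiffOn_Icc hT t ht).eq_deriv _ h
    ((hasDerivWithinAt_const t (Icc 0 T) (0 : L)).congr hex.output (hex.output t ht))

theorem IsExact.acc_eq_zero (hT : 0 < T) (hex : S.IsExact T ye lam) :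
    ∀ t ∈ Icc 0 T, S.acc (ye t, lam t) = 0 := by
  intro t ht
  have h := (S.differentiable_w1 (ye t)).hasFDerivAt.comp_hasDerivWithinAt t (hex.deriv t ht)
  rw [S.fderiv_w1] at h
  exact (uniqueDiffOn_Icc hT t ht).eq_deriv _ h
    ((hasDerivWithinAt_const t (Icc 0 T) (0 : L)).congr (hex.w1_eq_zero hT)
      (hex.w1_eq_zero hT t ht))

/-- No regularity of `lam` is assumed: its bound comes from `G(ye) lam = acc(ye, 0)` and the lower
bound for `G`. The margin `2` leaves one unit for the discretization error and one for the motion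
within a step. -/
theorem IsExact.exists_radius [FiniteDimensional ℝ Y] [FiniteDimensional ℝ L] (hT : 0 < T)
    (hex : S.IsExact T ye lam) :
    ∃ R, ∀ t ∈ Icc 0 T, ‖ye t‖ ≤ R - 2 ∧ ‖lam t‖ ≤ R - 2 := by
  have hc : ContinuousOn ye (Icc 0 T) := fun t ht => (hex.deriv t ht).continuousWithinAt
  obtain ⟨R1, h1⟩ := isCompact_Icc.exists_bound_of_continuousOn hc
  obtain ⟨κ, hκ, hG⟩ := exists_uniform_lower_bound S.differentiable_w0.continuous S.continuous_G
    S.injective_G R1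
  have hca : ContinuousOn (fun t => S.acc (ye t, 0)) (Icc 0 T) :=
    S.contDiff_acc.continuous.comp_continuousOn (hc.prodMk continuousOn_const)
  obtain ⟨R2, h2⟩ := isCompact_Icc.exists_bound_of_continuousOn hca
  refine ⟨max R1 (κ * R2) + 2, fun t ht => ⟨?_, ?_⟩⟩
  · rw [add_sub_cancel_right]
    exact (h1 t ht).trans (le_max_left _ _)
  · rw [add_sub_cancel_right]
    refine le_trans ?_ (le_max_right _ _)
    have h := S.acc_sub (ye t) (lam t) 0
    rw [hex.acc_eq_zero hT t ht, sub_zero, zero_sub, neg_inj] at h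
    refine (hG (ye t) (h1 t ht) (hex.output t ht) (lam t)).trans ?_
    rw [← h]
    exact mul_le_mul_of_nonneg_left (h2 t ht) (by linarith)

theorem IsExact.norm_sub_le (hex : S.IsExact T ye lam) (B : S.Bounds R K)
    (hR : ∀ t ∈ Icc 0 T, ‖ye t‖ ≤ R - 2 ∧ ‖lam t‖ ≤ R - 2) {s t : ℝ} (hs : s ∈ Icc 0 T)
    (ht : t ∈ Icc 0 T) : ‖ye t - ye s‖ ≤ K * ‖t - s‖ :=
  (convex_Icc 0 T).norm_image_sub_le_of_norm_hasDerivWithin_le hex.deriv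
    (fun x hx => (B.f_lt _ (max_le (by have := (hR x hx).1; simp only; linarith)
      (by have := (hR x hx).2; simp only; linarith))).le) hs ht

/-- Lipschitz continuity of the control is again automatic: `G(ye t)(lam t - lam s) = acc(ye t, lam
s)`, and `acc(ye s, lam s) = 0`. Each of `G`, `acc` and `ye` contributes a factor `K`. -/
theorem IsExact.norm_control_sub_le (hT : 0 < T) (hex : S.IsExact T ye lam) (B : S.Bounds R K)
    (hR : ∀ t ∈ Icc 0 T, ‖ye t‖ ≤ R - 2 ∧ ‖lam t‖ ≤ R - 2) {s t : ℝ} (hs : s ∈ Icc 0 T)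
    (ht : t ∈ Icc 0 T) : ‖lam t - lam s‖ ≤ K ^ 3 * ‖t - s‖ := by
  have hle : ∀ r ∈ Icc 0 T, ∀ r' ∈ Icc 0 T, ‖(ye r, lam r')‖ ≤ R := fun r hr r' hr' =>
    max_le (by have := (hR r hr).1; simp only; linarith)
      (by have := (hR r' hr').2; simp only; linarith)
  refine (B.le_G (ye t) (by linarith [(hR t ht).1]) (hex.output t ht) _).trans ?_
  have h := S.acc_sub (ye t) (lam t) (lam s)
  rw [hex.acc_eq_zero hT t ht, zero_sub, neg_inj] at h
  rw [← h, ← sub_zero (S.acc (ye t, lam s)), ← hex.acc_eq_zero hT s hs]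
  have h1 := B.acc_lip _ _ (hle t ht s hs) (hle s hs s hs)
  have h2 := (norm_prod_sub_le (ye t) (ye s) (lam s) (lam s)).trans_eq
    (by rw [sub_self, norm_zero, add_zero])
  have h3 := hex.norm_sub_le B hR hs ht
  have hK := B.pos
  calc _ ≤ K * (K * (K * ‖t - s‖)) := by
        gcongr
        exact h1.trans (mul_le_mul_of_nonneg_left (h2.trans h3) hK.le)
    _ = _ := by ring

/-- The error of a state `y` at time `t` of a discretization with step size `h`: its distance to
the exact motion and the scaled deviation of the derivative of the output from its leading
term. -/
def err (S : OutputSystem Y L) (ye : ℝ → Y) (lam : ℝ → L) (h t : ℝ) (y : Y) : ℝ :=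
  ‖y - ye t‖ + ‖S.w1 y - (h ^ 2 / 12) • S.jerk (ye t, lam t)‖ / h

theorem err_nonneg {h t : ℝ} (hh : 0 < h) (y : Y) : 0 ≤ S.err ye lam h t y := by
  unfold err
  positivity

theorem norm_sub_le_err {h t : ℝ} (hh : 0 < h) (y : Y) : ‖y - ye t‖ ≤ S.err ye lam h t y :=
  le_add_of_nonneg_right (by positivity)

/-- Because of the division by `h` in `err`, a bound `err = O(h)` yields a hidden-constraint
residual `O(h²)`. -/
theorem norm_w1_le_err {h t : ℝ} (hh : 0 < h) (y : Y)
    (hj : ‖S.jerk (ye t, lam t)‖ ≤ K) :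
    ‖S.w1 y‖ ≤ h * S.err ye lam h t y + h ^ 2 / 12 * K := by
  have h1 := norm_le_norm_sub_add (S.w1 y) ((h ^ 2 / 12) • S.jerk (ye t, lam t))
  rw [norm_smul, Real.norm_of_nonneg (by positivity)] at h1
  have h2 : h * S.err ye lam h t y
      = h * ‖y - ye t‖ + ‖S.w1 y - (h ^ 2 / 12) • S.jerk (ye t, lam t)‖ := by
    unfold err
    field_simp
  have h3 : h ^ 2 / 12 * ‖S.jerk (ye t, lam t)‖ ≤ h ^ 2 / 12 * K :=
    mul_le_mul_of_nonneg_left hj (by positivity)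
  have h4 : 0 ≤ h * ‖y - ye t‖ := by positivity
  linarith

/-- Propagation in one step of the distance to the exact motion. -/
theorem IsExact.norm_sub_le_of_isFlow (hT : 0 < T) (hex : S.IsExact T ye lam)
    (B : S.Bounds R K) (hR : ∀ t ∈ Icc 0 T, ‖ye t‖ ≤ R - 2 ∧ ‖lam t‖ ≤ R - 2)
    {a b η : ℝ} {mu : L} {y : ℝ → Y} (hab : a < b) (haT : a ∈ Icc 0 T) (hbT : b ∈ Icc 0 T)
    (hKh : K * (b - a) ≤ 1) (hyaR : ‖y a‖ ≤ R - 1) (hmuR : ‖mu‖ ≤ R) (hflow : S.IsFlow a b mu y)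
    (hη : b - a ≤ η) (hyη : ‖y a - ye a‖ ≤ η) (hmuη : ‖mu - lam a‖ ≤ 4 * K ^ 2 * η) :
    ‖y b - ye b‖ ≤ ‖y a - ye a‖ + 12 * K ^ 4 * (b - a) * η := by
  have hK := B.one_le
  have hsub : Icc a b ⊆ Icc 0 T := Icc_subset_Icc haT.1 hbT.2
  have hh : 0 < b - a := sub_pos.2 hab
  have hη0 : 0 < η := hh.trans_le hη
  have hK3 : K ^ 2 ≤ K ^ 3 := pow_le_pow_right₀ hK (by norm_num)
  have hK4 : K ≤ K ^ 4 := le_self_pow₀ hK (by norm_num)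
  have h1 := norm_le_of_norm_deriv_le_affine (f := fun t => y t - ye t) B.pos hKh
    (ε := 5 * K ^ 4 * η) (by positivity)
    (fun s hs => (hflow s hs).sub ((hex.deriv s (hsub hs)).mono hsub)) (fun s hs => ?_)
    b (right_mem_Icc.2 hab.le)
  · have h2 : K * ‖y a - ye a‖ ≤ K ^ 4 * η :=
      mul_le_mul hK4 hyη (norm_nonneg _) (by positivity)
    have h3 : 2 * (b - a) * (K * ‖y a - ye a‖ + 5 * K ^ 4 * η)
        ≤ 2 * (b - a) * (K ^ 4 * η + 5 * K ^ 4 * η) := by gcongr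
    linarith
  · refine (B.f_lip _ _ (B.norm_le_of_isFlow hKh hyaR hmuR hflow s hs)
      (norm_prod_le_of_margin hR s (hsub hs))).trans ?_
    have h1 := norm_prod_sub_le (y s) (ye s) mu (lam s)
    have h2 := norm_sub_le_norm_sub_add_norm_sub mu (lam a) (lam s)
    have h3 := hex.norm_control_sub_le hT B hR (hsub hs) haT
    have h4 : ‖a - s‖ ≤ b - a := by
      rw [Real.norm_eq_abs, abs_le]
      constructor <;> linarith [hs.1, hs.2]
    have h5 : K ^ 3 * ‖a - s‖ ≤ K ^ 3 * η := by
      gcongr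
      exact h4.trans hη
    have h6 : 4 * K ^ 2 * η ≤ 4 * K ^ 3 * η := by gcongr
    have h7 : ‖(y s, mu) - (ye s, lam s)‖ ≤ ‖y s - ye s‖ + 5 * K ^ 3 * η := by linarith
    calc _ ≤ K * (‖y s - ye s‖ + 5 * K ^ 3 * η) := mul_le_mul_of_nonneg_left h7 B.pos.le
      _ = _ := by ring

/-- Propagation in one step of the deviation of the derivative of the output. -/
theorem IsExact.norm_w1_sub_le_of_isFlow (hT : 0 < T) (hex : S.IsExact T ye lam)
    (B : S.Bounds R K) (hR : ∀ t ∈ Icc 0 T, ‖ye t‖ ≤ R - 2 ∧ ‖lam t‖ ≤ R - 2)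
    {a b η : ℝ} {mu : L} {y : ℝ → Y} (hab : a < b) (haT : a ∈ Icc 0 T) (hbT : b ∈ Icc 0 T)
    (hKh : K * (b - a) ≤ 1) (hyaR : ‖y a‖ ≤ R - 1) (hmuR : ‖mu‖ ≤ R) (hflow : S.IsFlow a b mu y)
    (hη : b - a ≤ η) (hyη : ‖y a - ye a‖ ≤ η) (hmuη : ‖mu - lam a‖ ≤ 4 * K ^ 2 * η)
    (h0 : S.w0 (y a) = 0) (hb : S.w0 (y b) = 0) :
    ‖S.w1 (y b) - ((b - a) ^ 2 / 12) • S.jerk (ye b, lam b)‖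
      ≤ ‖S.w1 (y a) - ((b - a) ^ 2 / 12) • S.jerk (ye a, lam a)‖
        + (b - a) * (5 * K ^ 4 * (b - a) * η) := by
  have hK := B.one_le
  have hh : 0 < b - a := sub_pos.2 hab
  have hη0 : 0 < η := hh.trans_le hη
  have h1 := B.norm_w1_add_w1_le hab hKh hyaR hmuR hflow h0 hb
  have h2 : ‖S.jerk (y a, mu) - S.jerk (ye a, lam a)‖ ≤ 5 * K ^ 3 * η := by
    refine (B.jerk_lip _ _ (B.norm_le_of_isFlow hKh hyaR hmuR hflow a (left_mem_Icc.2 hab.le))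
      (norm_prod_le_of_margin hR a haT)).trans ?_
    have e1 := norm_prod_sub_le (y a) (ye a) mu (lam a)
    have e2 : η ≤ K ^ 2 * η := le_mul_of_one_le_left hη0.le (one_le_pow₀ hK)
    have e3 : ‖(y a, mu) - (ye a, lam a)‖ ≤ 5 * K ^ 2 * η := by linarith
    calc _ ≤ K * (5 * K ^ 2 * η) := mul_le_mul_of_nonneg_left e3 B.pos.le
      _ = _ := by ring
  have h3 : ‖S.jerk (ye a, lam a) - S.jerk (ye b, lam b)‖ ≤ 2 * K ^ 4 * (b - a) := by
    refine (B.jerk_lip _ _ (norm_prod_le_of_margin hR a haT) (norm_prod_le_of_margin hR b hbT)).trans ?_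
    have e1 := norm_prod_sub_le (ye a) (ye b) (lam a) (lam b)
    have e2 := hex.norm_sub_le B hR hbT haT
    have e3 := hex.norm_control_sub_le hT B hR hbT haT
    have e4 : ‖a - b‖ = b - a := by
      rw [Real.norm_eq_abs, abs_sub_comm, abs_of_pos hh]
    rw [e4] at e2 e3
    have e5 : K * (b - a) ≤ K ^ 3 * (b - a) :=
      mul_le_mul_of_nonneg_right (le_self_pow₀ hK (by norm_num)) hh.le
    have e6 : ‖(ye a, lam a) - (ye b, lam b)‖ ≤ 2 * K ^ 3 * (b - a) := by linarith
    calc _ ≤ K * (2 * K ^ 3 * (b - a)) := mul_le_mul_of_nonneg_left e6 B.pos.le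
      _ = _ := by ring
  set h := b - a
  -- For a frozen jerk, `(h²/12) jerk` is the fixed point of the recursion `w' = -w + (h²/6) jerk`.
  rw [show h ^ 2 / 6 = 2 * (h ^ 2 / 12) by ring] at h1
  have h4 := norm_sub_smul_le_of_norm_add_sub_smul_le (c := h ^ 2 / 12) (by positivity) h1 h2 h3
  have h5 : h ^ 2 * (K ^ 2 * h) ≤ h ^ 2 * (K ^ 4 * η) := by
    gcongr
    norm_num
  have h6 : h ^ 2 * (K ^ 3 * η) ≤ h ^ 2 * (K ^ 4 * η) := by
    gcongr
    norm_num
  have h7 : h ^ 2 * (K ^ 4 * h) ≤ h ^ 2 * (K ^ 4 * η) := by gcongr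
  have h8 : 0 ≤ h ^ 2 * (K ^ 4 * η) := by positivity
  linarith

/-- Existence and error propagation of one step. -/
theorem IsExact.exists_step [FiniteDimensional ℝ Y] [FiniteDimensional ℝ L] (hT : 0 < T)
    (hex : S.IsExact T ye lam) (B : S.Bounds R K)
    (hR : ∀ t ∈ Icc 0 T, ‖ye t‖ ≤ R - 2 ∧ ‖lam t‖ ≤ R - 2) {h a b : ℝ} (hh : 0 < h)
    (ha : 0 ≤ a) (hb : b = a + h) (hbT : b ≤ T) (hKh : 8 * K ^ 2 * h ≤ 1) {y₀ : Y}
    (h0 : S.w0 y₀ = 0) (hsmall : 8 * K ^ 2 * (S.err ye lam h a y₀ + h) ≤ 1) :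
    ∃ mu y, S.IsFlow a b mu y ∧ y a = y₀ ∧ S.w0 (y b) = 0 ∧
      ‖mu - lam a‖ ≤ 4 * K ^ 2 * (S.err ye lam h a y₀ + h) ∧
      S.err ye lam h b (y b) + h ≤ (1 + 17 * K ^ 4 * h) * (S.err ye lam h a y₀ + h) := by
  have hK := B.one_le
  have hba : b - a = h := by linarith
  have hab : a < b := by linarith
  have haT : a ∈ Icc 0 T := ⟨ha, by linarith⟩
  have hbT' : b ∈ Icc 0 T := ⟨by linarith, hbT⟩
  have hle := norm_prod_le_of_margin hR
  have hsub : Icc a b ⊆ Icc 0 T := Icc_subset_Icc ha hbT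
  have hE0 := err_nonneg (S := S) (ye := ye) (lam := lam) (t := a) hh y₀
  have heE := norm_sub_le_err (S := S) (ye := ye) (lam := lam) (t := a) hh y₀
  have hwE := norm_w1_le_err hh y₀ (B.jerk_le _ (hle a haT))
  set E := S.err ye lam h a y₀ with hE
  have hK2 : 1 ≤ K ^ 2 := one_le_pow₀ hK
  have hKK2 : K ≤ K ^ 2 := by nlinarith
  have hK3 : K ^ 2 ≤ K ^ 3 := pow_le_pow_right₀ hK (by norm_num)
  have hK4 : K ^ 3 ≤ K ^ 4 := pow_le_pow_right₀ hK (by norm_num)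
  have hEh : E + h ≤ 1 / 8 := by nlinarith
  have hy₀ : ‖y₀‖ ≤ R - 1 := by
    have := norm_le_norm_sub_add y₀ (ye a)
    linarith [(hR a haT).1]
  have hacc : ‖S.acc (y₀, lam a)‖ ≤ K * E := by
    have h1 := B.acc_lip (y₀, lam a) (ye a, lam a)
      (max_le (by simp only; linarith) (by have := (hR a haT).2; simp only; linarith)) (hle a haT)
    rw [hex.acc_eq_zero hT a haT, sub_zero] at h1
    have h2 := norm_prod_sub_le y₀ (ye a) (lam a) (lam a)
    rw [sub_self, norm_zero, add_zero] at h2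
    exact h1.trans (mul_le_mul_of_nonneg_left (h2.trans heE) B.pos.le)
  -- This single bound serves both as the smallness condition for existence of the control and as
  -- the estimate of its error.
  have hctrl : K * (2 / (b - a) * ‖S.w1 y₀‖ + ‖S.acc (y₀, lam a)‖ + 2 * K * (b - a))
      ≤ 4 * K ^ 2 * (E + h) := by
    rw [hba]
    have h1 : 2 / h * ‖S.w1 y₀‖ ≤ 2 / h * (h * E + h ^ 2 / 12 * K) :=
      mul_le_mul_of_nonneg_left hwE (by positivity)
    have h2 : 2 / h * (h * E + h ^ 2 / 12 * K) = 2 * E + h * K / 6 := by field_simp; ring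
    have h3 : 2 / h * ‖S.w1 y₀‖ + ‖S.acc (y₀, lam a)‖ + 2 * K * h ≤ 4 * K * (E + h) := by
      have : E ≤ K * E := le_mul_of_one_le_left hE0 hK
      have : 0 ≤ K * h := mul_nonneg B.pos.le hh.le
      nlinarith
    calc _ ≤ K * (4 * K * (E + h)) := mul_le_mul_of_nonneg_left h3 B.pos.le
      _ = _ := by ring
  obtain ⟨mu, y, hmu1, hya, hflow, hyb⟩ := B.exists_control (a := a) (b := b) hab
    (by rwa [hba]) hy₀ h0 (ref := lam a) (by linarith [(hR a haT).2])
    (hctrl.trans (by linarith))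
  have hmuR : ‖mu‖ ≤ R := by
    have := norm_le_norm_sub_add mu (lam a)
    linarith [(hR a haT).2]
  have hKh' : K * (b - a) ≤ 1 := by rw [hba]; nlinarith
  have hyaR : ‖y a‖ ≤ R - 1 := by rwa [hya]
  have hmu : ‖mu - lam a‖ ≤ 4 * K ^ 2 * (E + h) := by
    refine (B.norm_control_sub_le hab hKh' hyaR hmuR hflow (by rwa [hya]) hyb (lam a)).trans ?_
    rwa [hya]
  refine ⟨mu, y, hflow, hya, hyb, hmu, ?_⟩
  have hdist := hex.norm_sub_le_of_isFlow hT B hR hab haT hbT' hKh' hyaR hmuR hflow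
    (η := E + h) (by linarith) (by rw [hya]; linarith) hmu
  have hout := hex.norm_w1_sub_le_of_isFlow hT B hR hab haT hbT' hKh' hyaR hmuR hflow
    (η := E + h) (by linarith) (by rw [hya]; linarith) hmu (by rwa [hya]) hyb
  rw [hya, hba] at hdist hout
  have hout' : ‖S.w1 (y b) - (h ^ 2 / 12) • S.jerk (ye b, lam b)‖ / h
      ≤ ‖S.w1 y₀ - (h ^ 2 / 12) • S.jerk (ye a, lam a)‖ / h + 5 * K ^ 4 * h * (E + h) := by
    have := div_le_div_of_nonneg_right hout hh.le
    rwa [add_div, mul_div_cancel_left₀ _ hh.ne'] at this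
  have hEdef : E = ‖y₀ - ye a‖ + ‖S.w1 y₀ - (h ^ 2 / 12) • S.jerk (ye a, lam a)‖ / h := rfl
  have hEb : S.err ye lam h b (y b)
      = ‖y b - ye b‖ + ‖S.w1 (y b) - (h ^ 2 / 12) • S.jerk (ye b, lam b)‖ / h := rfl
  -- The rate `17 K⁴` is `12 K⁴` from the state plus `5 K⁴` from the scaled output deviation.
  rw [hEb]
  linarith

/-- Convergence of the discretization by piecewise constant controls. -/
theorem IsExact.exists_discretization [FiniteDimensional ℝ Y] [FiniteDimensional ℝ L] (hT : 0 < T)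
    (hex : S.IsExact T ye lam) :
    ∃ C : ℝ, ∀ ρ : ℝ, 0 < ρ → ∃ h₀ : ℝ, 0 < h₀ ∧ ∀ h : ℝ, 0 < h → h ≤ h₀ →
      ∃ (y : ℕ → Y) (mu : ℕ → L), y 0 = ye 0 ∧
        (∀ n : ℕ, n * h ≤ T →
          ‖y n - ye (n * h)‖ ≤ C * h ∧ S.w0 (y n) = 0 ∧ ‖S.w1 (y n)‖ ≤ C * h ^ 2) ∧
        ∀ n : ℕ, ((n : ℝ) + 1) * h ≤ T →
          (∃ c, S.IsFlow (n * h) ((n + 1) * h) (mu n) c ∧ c (n * h) = y n ∧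
            c ((n + 1) * h) = y (n + 1)) ∧
          (∀ (mu' : L) (c : ℝ → Y), ‖mu' - lam (n * h)‖ ≤ ρ →
            S.IsFlow (n * h) ((n + 1) * h) mu' c → c (n * h) = y n →
            S.w0 (c ((n + 1) * h)) = 0 → mu' = mu n ∧ c ((n + 1) * h) = y (n + 1)) ∧
          ‖mu n - lam (n * h)‖ ≤ C * h := by
  obtain ⟨R, hR⟩ := hex.exists_radius hT
  obtain ⟨K, B⟩ := S.exists_bounds R
  have hK := B.one_le
  -- The factor `1 + K` covers the start: there `err + h` is `h + (h/12) ‖jerk‖`, since state error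
  -- and `w1` vanish.
  set C₁ := Real.exp (17 * K ^ 4 * T) * (1 + K) with hC₁
  have hC₁1 : 1 ≤ C₁ := by
    have : 1 ≤ Real.exp (17 * K ^ 4 * T) := Real.one_le_exp (by positivity)
    nlinarith
  refine ⟨4 * K ^ 2 * C₁ + C₁ + K, fun ρ hρ => ?_⟩
  -- The larger ball contains every control within `ρ` of the exact one. Its constant `K'` affects
  -- only `h₀`, so `C` does not depend on `ρ`.
  obtain ⟨K', B'⟩ := S.exists_bounds (R + ρ + 1)
  have hK' := B'.one_le
  refine ⟨1 / (8 * K ^ 2 * C₁ + 8 * K' ^ 2), by positivity, fun h hh hle => ?_⟩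
  have hle1 : (8 * K ^ 2 * C₁ + 8 * K' ^ 2) * h ≤ 1 := by
    rwa [le_div_iff₀ (by positivity), mul_comm] at hle
  have hKC : 8 * K ^ 2 * (C₁ * h) ≤ 1 := by
    have : 0 ≤ 8 * K' ^ 2 * h := by positivity
    linarith
  have hKK : 8 * K' ^ 2 * h ≤ 1 := by
    have : 0 ≤ 8 * K ^ 2 * C₁ * h := by positivity
    linarith
  have hKh : 8 * K ^ 2 * h ≤ 1 := by
    refine le_trans ?_ hKC
    gcongr
    exact le_mul_of_one_le_left hh.le hC₁1
  -- With the hypotheses placed under the existential, `choose` yields a total step map, so the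
  -- sequence can be defined by plain recursion before the error bounds are known.
  have hnext : ∀ (n : ℕ) (y : Y), ∃ p : L × Y, ((n : ℝ) + 1) * h ≤ T → S.w0 y = 0 →
      8 * K ^ 2 * (S.err ye lam h (n * h) y + h) ≤ 1 →
      (∃ c, S.IsFlow (n * h) ((n + 1) * h) p.1 c ∧ c (n * h) = y ∧ c ((n + 1) * h) = p.2) ∧
      S.w0 p.2 = 0 ∧ ‖p.1 - lam (n * h)‖ ≤ 4 * K ^ 2 * (S.err ye lam h (n * h) y + h) ∧
      S.err ye lam h ((n + 1) * h) p.2 + h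
        ≤ (1 + 17 * K ^ 4 * h) * (S.err ye lam h (n * h) y + h) := by
    intro n y
    by_cases hc : ((n : ℝ) + 1) * h ≤ T ∧ S.w0 y = 0 ∧
        8 * K ^ 2 * (S.err ye lam h (n * h) y + h) ≤ 1
    · obtain ⟨mu, c, h1, h2, h3, h4, h5⟩ := hex.exists_step hT B hR hh
        (a := n * h) (b := (n + 1) * h) (by positivity) (by ring) hc.1 hKh hc.2.1 hc.2.2
      exact ⟨(mu, c ((n + 1) * h)), fun _ _ _ => ⟨⟨c, h1, h2, rfl⟩, h3, h4, h5⟩⟩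
    · exact ⟨0, fun h1 h2 h3 => absurd ⟨h1, h2, h3⟩ hc⟩
  choose next hnext using hnext
  let y : ℕ → Y := fun n => Nat.rec (ye 0) (fun n x => (next n x).2) n
  have hy0 : y 0 = ye 0 := rfl
  have h0T : (0 : ℝ) ∈ Icc 0 T := ⟨le_rfl, hT.le⟩
  have hleR := norm_prod_le_of_margin hR
  have hgrow : ∀ n : ℕ, n * h ≤ T → (1 + 17 * K ^ 4 * h) ^ n * ((1 + K) * h) ≤ C₁ * h := by
    intro n hn
    have h1 : (1 + 17 * K ^ 4 * h) ^ n ≤ Real.exp (17 * K ^ 4 * T) := by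
      calc (1 + 17 * K ^ 4 * h) ^ n ≤ Real.exp (17 * K ^ 4 * h) ^ n := by
            gcongr
            linarith [Real.add_one_le_exp (17 * K ^ 4 * h)]
        _ = Real.exp (17 * K ^ 4 * (n * h)) := by rw [← Real.exp_nat_mul]; congr 1; ring
        _ ≤ _ := by gcongr
    calc _ ≤ Real.exp (17 * K ^ 4 * T) * ((1 + K) * h) := by gcongr
      _ = _ := by rw [hC₁]; ring
  have hinv : ∀ n : ℕ, n * h ≤ T → S.w0 (y n) = 0 ∧
      S.err ye lam h (n * h) (y n) + h ≤ (1 + 17 * K ^ 4 * h) ^ n * ((1 + K) * h) := by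
    intro n
    induction n with
    | zero =>
      intro _
      refine ⟨hy0 ▸ hex.output 0 h0T, ?_⟩
      simp only [hy0, err, Nat.cast_zero, zero_mul, sub_self, norm_zero, zero_add, pow_zero,
        one_mul, hex.w1_eq_zero hT 0 h0T, zero_sub, norm_neg, norm_smul]
      rw [Real.norm_of_nonneg (by positivity)]
      have h1 := B.jerk_le _ (hleR 0 h0T)
      have h2 : h ^ 2 / 12 * ‖S.jerk (ye 0, lam 0)‖ / h = h / 12 * ‖S.jerk (ye 0, lam 0)‖ := by
        field_simp
      have h3 : h / 12 * ‖S.jerk (ye 0, lam 0)‖ ≤ h / 12 * K := by gcongr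
      have h4 : 0 ≤ h * K := by positivity
      rw [h2]
      linarith
    | succ n ih =>
      intro hn
      rw [Nat.cast_add_one] at hn ⊢
      have hn' : n * h ≤ T := by linarith
      obtain ⟨i1, i2⟩ := ih hn'
      -- The accumulated bound `C₁ * h` supplies the smallness condition that allows another step.
      obtain ⟨-, j1, -, j2⟩ := hnext n (y n) hn i1 (le_trans
        (by gcongr; exact i2.trans (hgrow n hn')) hKC)
      refine ⟨j1, j2.trans ?_⟩
      calc _ ≤ (1 + 17 * K ^ 4 * h) * ((1 + 17 * K ^ 4 * h) ^ n * ((1 + K) * h)) :=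
            mul_le_mul_of_nonneg_left i2 (by positivity)
        _ = _ := by ring
  have herr : ∀ n : ℕ, n * h ≤ T → S.err ye lam h (n * h) (y n) + h ≤ C₁ * h := fun n hn =>
    (hinv n hn).2.trans (hgrow n hn)
  have hmem : ∀ n : ℕ, n * h ≤ T → (n : ℝ) * h ∈ Icc 0 T := fun n hn => ⟨by positivity, hn⟩
  refine ⟨y, fun n => (next n (y n)).1, hy0, fun n hn => ⟨?_, (hinv n hn).1, ?_⟩, fun n hn => ?_⟩
  · have h1 := norm_sub_le_err (S := S) (ye := ye) (lam := lam) (t := n * h) hh (y n)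
    have h2 := herr n hn
    have : 0 ≤ (4 * K ^ 2 * C₁ + K) * h := by positivity
    linarith
  · have h1 := norm_w1_le_err hh (y n) (B.jerk_le _ (hleR _ (hmem n hn)))
    have h2 : h * S.err ye lam h (n * h) (y n) ≤ h * (C₁ * h) := by
      have := herr n hn
      gcongr
      linarith
    have h3 : 0 ≤ (4 * K ^ 2 * C₁) * h ^ 2 := by positivity
    have h4 : 0 ≤ K * h ^ 2 := by positivity
    linarith
  · have hn' : n * h ≤ T := by linarith
    obtain ⟨⟨c, c1, c2, c3⟩, j1, j2, -⟩ := hnext n (y n) hn (hinv n hn').1 (le_trans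
      (by gcongr; exact herr n hn') hKC)
    have hmu : ‖(next n (y n)).1 - lam (n * h)‖ ≤ 4 * K ^ 2 * (C₁ * h) := j2.trans (by
      gcongr
      exact herr n hn')
    refine ⟨⟨c, c1, c2, c3⟩, fun mu' c' hmu' d1 d2 d3 => ?_, ?_⟩
    · have hlam := (hR _ (hmem n hn')).2
      have e1 := norm_le_norm_sub_add (next n (y n)).1 (lam (n * h))
      have e2 := norm_le_norm_sub_add mu' (lam (n * h))
      have e3 := norm_le_norm_sub_add (y n) (ye (n * h))
      have e4 := norm_sub_le_err (S := S) (ye := ye) (lam := lam) (t := n * h) hh (y n)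
      have e5 := herr n hn'
      have e6 : C₁ * h ≤ 1 := by
        have : 1 ≤ 8 * K ^ 2 := by nlinarith
        have : C₁ * h ≤ 8 * K ^ 2 * (C₁ * h) := le_mul_of_one_le_left (by positivity) this
        linarith
      have e7 := (hR _ (hmem n hn')).1
      have hu := B'.control_unique (a := n * h) (b := (n + 1) * h) (y := c') (y' := c)
        (mu := mu') (mu' := (next n (y n)).1) (by linarith) (by rwa [add_one_mul, add_sub_cancel_left])
        (by rw [d2]; linarith) (c2.trans d2.symm) (by linarith) (by linarith) d1 c1
        (by rw [d2]; exact (hinv n hn').1) d3 (by rw [c3]; exact j1)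
      exact ⟨hu.1, hu.2.trans c3⟩
    · have : 0 ≤ (C₁ + K) * h := by positivity
      linarith

end OutputSystem

/-! ### Matrix-vector products as continuous linear maps. -/

section Matrices

variable {a b c : ℕ}

theorem mulV_apply (A : Matrix (Fin a) (Fin b) ℝ) (x : Vec b) (i : Fin a) :
    mulV A x i = ∑ j, A i j * x j := rfl

/-- `mulV` as a continuous linear map. -/
def mulVL (A : Matrix (Fin a) (Fin b) ℝ) : Vec b →L[ℝ] Vec a :=
  LinearMap.toContinuousLinearMap
    { toFun := mulV A
      map_add' := fun x y => by ext i; simp [mulV_apply, mul_add, Finset.sum_add_distrib]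
      map_smul' := fun r x => by ext i; simp [mulV_apply, Finset.mul_sum, mul_left_comm] }

theorem mulVL_apply (A : Matrix (Fin a) (Fin b) ℝ) (x : Vec b) : mulVL A x = mulV A x := rfl

theorem mulV_mul (A : Matrix (Fin a) (Fin b) ℝ) (B : Matrix (Fin b) (Fin c) ℝ) (x : Vec c) :
    mulV (A * B) x = mulV A (mulV B x) := by
  simp [mulV, Matrix.mulVec_mulVec]

theorem inner_mulV_left (A : Matrix (Fin a) (Fin b) ℝ) (x : Vec b) (y : Vec a) :
    inner ℝ (mulV A x) y = inner ℝ x (mulV A.transpose y) := by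
  simp only [PiLp.inner_apply, mulV_apply, RCLike.inner_apply, conj_trivial,
    Matrix.transpose_apply, Finset.mul_sum, Finset.sum_mul]
  rw [Finset.sum_comm]
  exact Finset.sum_congr rfl fun i _ => Finset.sum_congr rfl fun j _ => by ring

end Matrices

/-! ### The constrained Hamiltonian problem as an output system. -/

variable {m ν : ℕ} {M : Matrix (Fin m) (Fin m) ℝ} {U : Vec m → ℝ} {g : Vec m → Vec ν}

theorem mulV_gradC_transpose (g : Vec m → Vec ν) (q x : Vec m) :
    mulV (gradC g q).transpose x = fderiv ℝ g q x := by
  have hx : x = ∑ i, x i • EuclideanSpace.single i (1 : ℝ) := by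
    ext k
    simp [Finset.sum_apply, Pi.single_apply]
  conv_rhs => rw [hx]
  ext j
  simp [mulV_apply, gradC, mul_comm]

theorem mulV_gramC (M : Matrix (Fin m) (Fin m) ℝ) (g : Vec m → Vec ν) (q : Vec m) (l : Vec ν) :
    mulV (gramC M g q) l = fderiv ℝ g q (mulV M⁻¹ (mulV (gradC g q) l)) := by
  rw [gramC, mulV_mul, mulV_mul, mulV_gradC_transpose]

theorem hidden_eq (M : Matrix (Fin m) (Fin m) ℝ) (g : Vec m → Vec ν) (q p : Vec m) :
    hidden M g q p = fderiv ℝ g q (mulV M⁻¹ p) := mulV_gradC_transpose g q _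

theorem inner_gradient (U : Vec m → ℝ) (q x : Vec m) :
    inner ℝ (gradient U q) x = fderiv ℝ U q x := by
  simp [gradient]

theorem gradient_apply (U : Vec m → ℝ) (q : Vec m) (i : Fin m) :
    gradient U q i = fderiv ℝ U q (EuclideanSpace.single i (1 : ℝ)) := by
  rw [← inner_gradient, EuclideanSpace.inner_single_right]
  simp

theorem contDiff_gradient (hU : ContDiff ℝ ⊤ U) : ContDiff ℝ ⊤ (gradient U) := by
  rw [contDiff_euclidean]
  intro i
  simp only [gradient_apply]
  exact (hU.fderiv_right (m := ⊤) le_top).clm_apply contDiff_const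

theorem contDiff_mulV_gradC (hg : ContDiff ℝ ⊤ g) :
    ContDiff ℝ ⊤ fun x : Vec m × Vec ν => mulV (gradC g x.1) x.2 := by
  rw [contDiff_euclidean]
  intro i
  simp only [mulV_apply, gradC, Matrix.of_apply]
  refine ContDiff.sum fun j _ => ContDiff.mul ?_ ?_
  · exact contDiff_euclidean.1 (((hg.fderiv_right (m := ⊤) le_top).comp contDiff_fst).clm_apply
      contDiff_const) j
  · exact contDiff_euclidean.1 contDiff_snd j

/-- The right-hand side of the equations of motion. -/
def field (M : Matrix (Fin m) (Fin m) ℝ) (U : Vec m → ℝ) (g : Vec m → Vec ν)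
    (x : (Vec m × Vec m) × Vec ν) : Vec m × Vec m :=
  (mulV M⁻¹ x.1.2, -gradient U x.1.1 - mulV (gradC g x.1.1) x.2)

/-- The second derivative of `g(q)` along motions. -/
def constraintAcc (M : Matrix (Fin m) (Fin m) ℝ) (U : Vec m → ℝ) (g : Vec m → Vec ν)
    (x : (Vec m × Vec m) × Vec ν) : Vec ν :=
  fderiv ℝ (fderiv ℝ g) x.1.1 (mulV M⁻¹ x.1.2) (mulV M⁻¹ x.1.2)
    + fderiv ℝ g x.1.1 (mulV M⁻¹ (field M U g x).2)

theorem contDiff_field (hU : ContDiff ℝ ⊤ U) (hg : ContDiff ℝ ⊤ g) :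
    ContDiff ℝ ⊤ (field M U g) :=
  ((mulVL M⁻¹).contDiff.comp (contDiff_snd.comp contDiff_fst)).prodMk
    (((contDiff_gradient hU).comp (contDiff_fst.comp contDiff_fst)).neg.sub
      ((contDiff_mulV_gradC hg).comp ((contDiff_fst.comp contDiff_fst).prodMk contDiff_snd)))

theorem contDiff_constraintAcc (hU : ContDiff ℝ ⊤ U) (hg : ContDiff ℝ ⊤ g) :
    ContDiff ℝ ⊤ (constraintAcc M U g) := by
  have hg1 : ContDiff ℝ ⊤ (fderiv ℝ g) := hg.fderiv_right le_top
  have hg2 : ContDiff ℝ ⊤ (fderiv ℝ (fderiv ℝ g)) := hg1.fderiv_right le_top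
  have hv : ContDiff ℝ ⊤ fun x : (Vec m × Vec m) × Vec ν => mulV M⁻¹ x.1.2 :=
    (mulVL M⁻¹).contDiff.comp (contDiff_snd.comp contDiff_fst)
  exact (((hg2.comp (contDiff_fst.comp contDiff_fst)).clm_apply hv).clm_apply hv).add
    ((hg1.comp (contDiff_fst.comp contDiff_fst)).clm_apply
      ((mulVL M⁻¹).contDiff.comp (contDiff_field hU hg).snd))

theorem fderiv_hidden (hg : ContDiff ℝ ⊤ g) (y v : Vec m × Vec m) :
    DifferentiableAt ℝ (fun y : Vec m × Vec m => hidden M g y.1 y.2) y ∧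
    fderiv ℝ (fun y : Vec m × Vec m => hidden M g y.1 y.2) y v
      = fderiv ℝ (fderiv ℝ g) y.1 v.1 (mulV M⁻¹ y.2) + fderiv ℝ g y.1 (mulV M⁻¹ v.2) := by
  have hg1 : ContDiff ℝ ⊤ (fderiv ℝ g) := hg.fderiv_right le_top
  have h1 := ((hg1.differentiable (by simp)) y.1).hasFDerivAt.comp y
    (hasFDerivAt_fst (𝕜 := ℝ) (p := y))
  have h2 := (mulVL M⁻¹).hasFDerivAt.comp y (hasFDerivAt_snd (𝕜 := ℝ) (p := y))
  have h : HasFDerivAt (fun y : Vec m × Vec m => hidden M g y.1 y.2) _ y :=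
    (h1.clm_apply h2).congr_of_eventuallyEq
      (Filter.Eventually.of_forall fun z => hidden_eq M g z.1 z.2)
  refine ⟨h.differentiableAt, ?_⟩
  rw [h.fderiv]
  simp [mulVL_apply, add_comm]

/-- This exhibits the affine dependence on the multiplier, with the Gram matrix in the role of `G`;
the root in `l` is the formula for `λ(q,p)`. -/
theorem constraintAcc_eq (q p : Vec m) (l : Vec ν) :
    constraintAcc M U g ((q, p), l)
      = (fderiv ℝ (fderiv ℝ g) q (mulV M⁻¹ p) (mulV M⁻¹ p)
        - mulV (gradC g q).transpose (mulV M⁻¹ (gradient U q))) - mulV (gramC M g q) l := by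
  rw [mulV_gramC, mulV_gradC_transpose]
  simp only [constraintAcc, field, ← mulVL_apply, map_sub, map_neg]
  abel

/-- The constrained Hamiltonian problem as a control system with output `g(q)`, the control being
the multiplier. -/
def hamSystem (M : Matrix (Fin m) (Fin m) ℝ) (hU : ContDiff ℝ ⊤ U) (hg : ContDiff ℝ ⊤ g)
    (hreg : ∀ x, g x = 0 → IsUnit (gramC M g x)) : OutputSystem (Vec m × Vec m) (Vec ν) where
  f := field M U g
  w0 := fun y => g y.1
  w1 := fun y => hidden M g y.1 y.2
  acc := constraintAcc M U g
  G := fun y => mulVL (gramC M g y.1)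
  contDiff_f := (contDiff_field hU hg).of_le le_top
  differentiable_w0 := (hg.differentiable (by simp)).comp differentiable_fst
  differentiable_w1 := fun y => (fderiv_hidden hg y 0).1
  contDiff_acc := (contDiff_constraintAcc hU hg).of_le le_top
  continuous_G := by
    rw [continuous_clm_apply]
    intro l
    simp only [mulVL_apply, mulV_gramC]
    have h1 : Continuous fun y : Vec m × Vec m => mulV (gradC g y.1) l :=
      (contDiff_mulV_gradC hg).continuous.comp (continuous_fst.prodMk continuous_const)
    exact ((hg.continuous_fderiv (by simp)).comp continuous_fst).clm_apply
      ((mulVL M⁻¹).continuous.comp h1)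
  fderiv_w0 := fun y mu => by
    have h := ((hg.differentiable (by simp)) y.1).hasFDerivAt.comp y
      (hasFDerivAt_fst (𝕜 := ℝ) (p := y))
    change fderiv ℝ (g ∘ Prod.fst) y _ = _
    rw [h.fderiv, hidden_eq]
    rfl
  fderiv_w1 := fun y mu => (fderiv_hidden hg y _).2
  acc_sub := fun y mu mu' => by
    rw [constraintAcc_eq, constraintAcc_eq, map_sub, mulVL_apply, mulVL_apply]
    abel
  injective_G := fun y hy l l' h => by
    have hinj := Matrix.mulVec_injective_of_isUnit (hreg y.1 hy)
    have h' := congrArg WithLp.ofLp h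
    exact WithLp.ofLp_injective 2 (hinj h')

theorem multiplier_eq_of_constraintAcc_eq_zero {q p : Vec m} {l : Vec ν}
    (hq : IsUnit (gramC M g q)) (h : constraintAcc M U g ((q, p), l) = 0) :
    multiplier M U g q p = l := by
  rw [constraintAcc_eq, sub_eq_zero] at h
  change mulV (gramC M g q)⁻¹ (fderiv ℝ (fderiv ℝ g) q (mulV M⁻¹ p) (mulV M⁻¹ p)
    - mulV (gradC g q).transpose (mulV M⁻¹ (gradient U q))) = l
  rw [h, ← mulV_mul, Matrix.nonsing_inv_mul _ ((Matrix.isUnit_iff_isUnit_det _).1 hq)]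
  simp [mulV]

theorem isMotion_iff {a b : ℝ} {lam : ℝ → Vec ν} {y : ℝ → Vec m × Vec m} :
    IsMotion M U g a b lam (fun t => (y t).1) (fun t => (y t).2) ↔
      ∀ t ∈ Icc a b, HasDerivWithinAt y (field M U g (y t, lam t)) (Icc a b) t :=
  ⟨fun h t ht => (h.deriv_q t ht).prodMk (h.deriv_p t ht), fun h =>
    ⟨fun t ht => (h t ht).fst, fun t ht => (h t ht).snd⟩⟩

/-- A motion with constant multiplier whose end points satisfy the constraint preserves the
energy. -/
theorem IsMotion.energy_eq (hM : M.PosDef) (hU : Differentiable ℝ U) (hg : Differentiable ℝ g)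
    {a b : ℝ} (hab : a ≤ b) {mu : Vec ν} {u v : ℝ → Vec m}
    (h : IsMotion M U g a b (fun _ => mu) u v) (ha : g (u a) = 0) (hb : g (u b) = 0) :
    energy M U (u b) (v b) = energy M U (u a) (v a) := by
  have hsymm : M⁻¹.transpose = M⁻¹ := by
    simpa [Matrix.IsHermitian, Matrix.conjTranspose_eq_transpose_of_trivial] using
      hM.inv.isHermitian
  -- For constant `mu` the force is `-∇(U + ⟨mu, g⟩)`, so the augmented energy is conserved.
  have hd : ∀ t ∈ Icc a b, HasDerivWithinAt
      (fun t => energy M U (u t) (v t) + inner ℝ mu (g (u t))) 0 (Icc a b) t := by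
    intro t ht
    have hv := h.deriv_p t ht
    have h1 := (hv.inner ℝ ((mulVL M⁻¹).hasFDerivAt.comp_hasDerivWithinAt t hv)).const_mul
      (1 / 2 : ℝ)
    have h2 := (hU (u t)).hasFDerivAt.comp_hasDerivWithinAt t (h.deriv_q t ht)
    have h3 := (hasDerivWithinAt_const t (Icc a b) mu).inner ℝ
      ((hg (u t)).hasFDerivAt.comp_hasDerivWithinAt t (h.deriv_q t ht))
    refine ((h1.add h2).add h3).congr_deriv ?_
    simp only [Function.comp_apply, mulVL_apply]
    set F := -gradient U (u t) - mulV (gradC g (u t)) mu with hF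
    have e1 : inner ℝ (v t) (mulV M⁻¹ F) = inner ℝ F (mulV M⁻¹ (v t)) := by
      rw [real_inner_comm, inner_mulV_left, hsymm]
    have e2 : inner ℝ F (mulV M⁻¹ (v t)) = -fderiv ℝ U (u t) (mulV M⁻¹ (v t))
        - inner ℝ mu (fderiv ℝ g (u t) (mulV M⁻¹ (v t))) := by
      rw [hF, inner_sub_left, inner_neg_left, inner_gradient, inner_mulV_left,
        mulV_gradC_transpose]
    rw [e1, e2, inner_zero_left]
    ring
  have hc := norm_image_sub_le_of_norm_deriv_le_segment' hd (C := 0) (fun _ _ => by simp) b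
    (right_mem_Icc.2 hab)
  rw [zero_mul, norm_le_zero_iff, ha, hb] at hc
  linarith

end ConstrainedHam

end

/-! ### Transfer of the abstract convergence result to the Hamiltonian problem. -/

theorem corollary2 (m ν : ℕ) (hν : ν < m)
    (M : Matrix (Fin m) (Fin m) ℝ) (hM : M.PosDef)
    (U : ConstrainedHam.Vec m → ℝ) (hU : AnalyticOnNhd ℝ U Set.univ)
    (g : ConstrainedHam.Vec m → ConstrainedHam.Vec ν) (hg : AnalyticOnNhd ℝ g Set.univ)
    (hreg : ∀ x : ConstrainedHam.Vec m, g x = 0 → IsUnit (ConstrainedHam.gramC M g x))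
    (q₀ p₀ : ConstrainedHam.Vec m) (hq₀ : g q₀ = 0) (hp₀ : ConstrainedHam.hidden M g q₀ p₀ = 0)
    (T : ℝ) (hT : 0 < T)
    (qex pex : ℝ → ConstrainedHam.Vec m) (lamex : ℝ → ConstrainedHam.Vec ν)
    (hsol : ConstrainedHam.IsConstrainedSolution M U g q₀ p₀ T qex pex lamex) :
    ∃ C : ℝ, ∀ ρ : ℝ, 0 < ρ → ∃ h₀ : ℝ, 0 < h₀ ∧ ∀ h : ℝ, 0 < h → h ≤ h₀ →
      ∃ (q p : ℕ → ConstrainedHam.Vec m) (lam : ℕ → ConstrainedHam.Vec ν),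
        q 0 = q₀ ∧ p 0 = p₀ ∧
        (∀ n : ℕ, (n : ℝ) * h ≤ T →
          ‖q n - qex (n * h)‖ ≤ C * h ∧
          ‖p n - pex (n * h)‖ ≤ C * h ∧
          g (q n) = 0 ∧
          ‖ConstrainedHam.hidden M g (q n) (p n)‖ ≤ C * h ^ 2) ∧
        (∀ n : ℕ, ((n : ℝ) + 1) * h ≤ T →
          ConstrainedHam.IsStep M U g (n * h) ((n + 1) * h)
            (q n) (p n) (lam n) (q (n + 1)) (p (n + 1)) ∧
          (∀ (mu : ConstrainedHam.Vec ν) (q' p' : ConstrainedHam.Vec m),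
            ‖mu - ConstrainedHam.multiplier M U g (qex (n * h)) (pex (n * h))‖ ≤ ρ →
            ConstrainedHam.IsStep M U g (n * h) ((n + 1) * h) (q n) (p n) mu q' p' →
            mu = lam n ∧ q' = q (n + 1) ∧ p' = p (n + 1)) ∧
          ‖lam n - ConstrainedHam.multiplier M U g (qex (n * h)) (pex (n * h))‖ ≤ C * h ∧
          ConstrainedHam.energy M U (q (n + 1)) (p (n + 1))
            = ConstrainedHam.energy M U (q n) (p n)) := by
  open ConstrainedHam in
  have hU' : ContDiff ℝ ⊤ U := contDiff_iff_contDiffAt.2 fun x => (hU x (mem_univ x)).contDiffAt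
  have hg' : ContDiff ℝ ⊤ g := contDiff_iff_contDiffAt.2 fun x => (hg x (mem_univ x)).contDiffAt
  have hex : (hamSystem M hU' hg' hreg).IsExact T (fun t => (qex t, pex t)) lamex :=
    ⟨fun t ht => (hsol.motion.deriv_q t ht).prodMk (hsol.motion.deriv_p t ht), hsol.constr⟩
  -- The exact acceleration of the constraint vanishes, which identifies the given multiplier with
  -- `λ(q,p)` on the whole interval.
  have hmult : ∀ t ∈ Icc 0 T, multiplier M U g (qex t) (pex t) = lamex t := fun t ht =>
    multiplier_eq_of_constraintAcc_eq_zero (hreg _ (hsol.constr t ht)) (hex.acc_eq_zero hT t ht)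
  obtain ⟨C, hC⟩ := hex.exists_discretization hT
  refine ⟨C, fun ρ hρ => ?_⟩
  obtain ⟨h₀, hh₀, H⟩ := hC ρ hρ
  refine ⟨h₀, hh₀, fun h hh hle => ?_⟩
  obtain ⟨y, mu, hy0, hy, hstep⟩ := H h hh hle
  refine ⟨fun n => (y n).1, fun n => (y n).2, mu, ?_, ?_, fun n hn => ?_, fun n hn => ?_⟩
  · simp only [hy0, hsol.init_q]
  · simp only [hy0, hsol.init_p]
  · obtain ⟨h1, h2, h3⟩ := hy n hn
    exact ⟨(norm_fst_le _).trans h1, (norm_snd_le _).trans h1, h2, h3⟩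
  · obtain ⟨⟨c, c1, c2, c3⟩, huniq, hlam⟩ := hstep n hn
    have hn' : n * h ≤ T := by linarith
    have hend : g (y (n + 1)).1 = 0 := (hy (n + 1) (by push_cast; exact hn)).2.1
    have hmot : IsMotion M U g (n * h) ((n + 1) * h) (fun _ => mu n) (fun t => (c t).1)
      (fun t => (c t).2) := isMotion_iff.2 c1
    rw [hmult (n * h) ⟨by positivity, hn'⟩]
    refine ⟨⟨_, _, hmot, by simp only [c2], by simp only [c2], by simp only [c3],
      by simp only [c3], hend⟩, fun mu' q' p' hmu' hs => ?_, hlam, ?_⟩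
    · obtain ⟨u, v, hm, hu, hv, hq', hp', hg0⟩ := hs
      have := huniq mu' (fun t => (u t, v t)) hmu'
        (fun t ht => (hm.deriv_q t ht).prodMk (hm.deriv_p t ht))
        (by simp only [hu, hv]) (by rw [← hq'] at hg0; exact hg0)
      simp only [hq', hp'] at this
      exact ⟨this.1, congrArg Prod.fst this.2, congrArg Prod.snd this.2⟩
    · have := hmot.energy_eq hM (hU'.differentiable (by simp)) (hg'.differentiable (by simp))
        (by linarith) (by simp only [c2]; exact (hy n hn').2.1) (by simp only [c3]; exact hend)
      simpa only [c2, c3] using this
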